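/- **Setting.** Let $\nu$ be a finite nonzero measure on a measurable space $\mathcal X$, let $t:\mathcal X\to\mathbb R^d$ be measurable with $\|t(x)\|_2\le R_2$ for all $x$, and let $p_\theta$ be the exponential family with density $p_\theta(x)=\exp(\theta\cdot t(x)-A(\theta))$ with respect to $\nu$, where $A(\theta)=\log\int e^{\theta\cdot t}\,d\nu$. For data $z_1,\dots,z_n\in\mathcal X$ ($n\ge1$) put $\bar t=\frac1n\sum_i t(z_i)$ and, for $\lambda>0$, $$f(\theta)=-\frac1n\sum_{i=1}^n\log p_\theta(z_i)+\frac\lambda2\|\theta\|_2^2 .$$ Let $L>0$ be a Lipschitz constant of the gradient: $\|f'(\theta)-f'(\phi)\|_2\le L\|\theta-\phi\|_2$ for all $\theta,\phi\in\mathbb R^d$. Let $\Theta\subseteq\mathbb R^d$ be closed and convex, let $\theta_0\in\Theta$ be the starting point, and let $\theta^*\in\arg\min_{\theta\in\Theta}f(\theta)$. For each $\theta$ let $\mathbb M_\theta$ be a Markov transition operator on $\mathcal X$ (depending measurably on $\theta$), and suppose that there are constants $C$ and $0<\alpha<1$ such that for all $\theta\in\Theta$, all probability distributions $q$ on $\mathcal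 X$ and all $v\ge 0$, $$\|\mathbb M_\theta^v q-p_\theta\|_{TV}=\sup_A|(\mathbb M_\theta^v q)(A)-p_\theta(A)|\le C\alpha^v .$$ **Algorithm.** Let $r$ be any probability distribution on $\mathcal X$. For $k=1,\dots,K$: given $\theta_{k-1}$, draw $M$ independent samples $x_1,\dots,x_M\sim\mathbb M_{\theta_{k-1}}^v r$ and set $$\theta_k=\Pi_\Theta\Big[\theta_{k-1}-\frac1L\Big(\frac1M\sum_{i=1}^M t(x_i)-\bar t+\lambda\theta_{k-1}\Big)\Big],$$ where $\Pi_\Theta$ is the Euclidean projection onto $\Theta$. The total work is the number $KMv$ of Markov transitions. **Statement.** Let $\epsilon>0$, $0<\delta<1$, $\beta_1,\beta_2,\beta_3>0$ with $\beta_1+\beta_2+\beta_3=1$. Put $D_0=\|\theta_0-\theta^*\|_2$ and $\bar L=\max\{L,1,\sqrt{2R_2}\}$ (so $\bar L=L$ whenever $L\ge1$ and $L^2\ge2R_2$; in particular whenever $L=4R_2^2+\lambda\ge1$). Define $$\kappa=\frac L\lambda\log\frac{D_0}{\beta_1\epsilon},\qquad \mu(K)=\frac{\bar L^2R_2}{2\epsilon^2\beta_2^2\lambda^2}\Big(1+\sqrt{2\log(K/\delta)}\Big)^2,\qquad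 \eta=\frac1{1-\alpha}\log\frac{2\bar LR_2C}{\beta_3\epsilon\lambda},$$ where $\log 0$ is read as $0$. 1. (Accuracy.) For all integers $K\ge1$, $M\ge1$, $v\ge0$ with $K\ge\kappa$, $M\ge\mu(K)$ and $v\ge\eta$, one has $\|\theta_K-\theta^*\|_2\le\epsilon$ with probability at least $1-\delta$. 2. (Total work.) If $c\ge1$ and the integers $K\ge1$, $M,v\ge0$ satisfy $K\le c\,\kappa$, $M\le c\,\mu(K)$ and $v\le c\,\eta$ (for $c=1$ and equality: $K$, $M$, $v$ meet the schedule exactly), then $$KMv\le c^3\,\frac{L\bar L^2R_2}{2\epsilon^2\beta_2^2\lambda^3(1-\alpha)}\log\Big(\frac{D_0}{\beta_1\epsilon}\Big)\left(1+\sqrt{2\log\Big(\frac{cL}{\lambda\delta}\log\Big(\frac{D_0}{\beta_1\epsilon}\Big)\Big)}\right)^2\log\Big(\frac{2\bar LR_2C}{\beta_3\epsilon\lambda}\Big).$$ Thus, when $\bar L=L$, the work is $O\big((L/\lambda)^3R_2/(\epsilon^2(1-\alpha))\big)$ up to logarithmic factors (the $\beta_i$ being fixed). 3. (Total work after rounding.)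 For the smallest integers that meet the schedule, $K=\max\{1,\lceil\kappa\rceil\}$, $M=\max\{1,\lceil\mu(K)\rceil\}$, $v=\max\{0,\lceil\eta\rceil\}$, $$KMv\le(\kappa^++1)\,\big(\mu(\kappa^++1)+1\big)\,(\eta^++1),\qquad x^+=\max\{0,x\}.$$ -/

import Mathlib

open MeasureTheory ProbabilityTheory

namespace MCMCLearn

/-- Total variation distance `sup_A |p(A) - q(A)|` over the measurable sets `A`. -/
noncomputable def tvDist {X : Type*} [MeasurableSpace X] (p q : Measure X) : ℝ :=
  ⨆ A : {A : Set X // MeasurableSet A}, |p.real A.1 - q.real A.1|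

section ExponentialFamily

/-- The log-partition function `A(θ) = log ∫ exp (θ · t(x)) dν(x)` of the exponential family with
sufficient statistics `t` with respect to the base measure `ν`. -/
noncomputable def logPartition {X : Type*} [MeasurableSpace X] {d : ℕ} (ν : Measure X)
    (t : X → EuclideanSpace ℝ (Fin d)) (θ : EuclideanSpace ℝ (Fin d)) : ℝ :=
  Real.log (∫ x, Real.exp (inner ℝ θ (t x)) ∂ν)

/-- The density `p_θ(x) = exp (θ · t(x) - A(θ))` with respect to the base measure. -/
noncomputable def density {X : Type*} [MeasurableSpace X] {d : ℕ} (ν : Measure X)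
    (t : X → EuclideanSpace ℝ (Fin d)) (θ : EuclideanSpace ℝ (Fin d)) (x : X) : ℝ :=
  Real.exp (inner ℝ θ (t x) - logPartition ν t θ)

/-- The distribution `p_θ`. -/
noncomputable def expFamily {X : Type*} [MeasurableSpace X] {d : ℕ} (ν : Measure X)
    (t : X → EuclideanSpace ℝ (Fin d)) (θ : EuclideanSpace ℝ (Fin d)) : Measure X :=
  ν.withDensity fun x => ENNReal.ofReal (density ν t θ x)

/-- The mean `t̄` of the sufficient statistics over the data `z`. -/
noncomputable def dataMean {X : Type*} {d n : ℕ}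
    (t : X → EuclideanSpace ℝ (Fin d)) (z : Fin n → X) : EuclideanSpace ℝ (Fin d) :=
  (1 / (n : ℝ)) • ∑ i, t (z i)

/-- The ridge-regularized negative log-likelihood
`f(θ) = - (1/n) ∑ log p_θ(z_i) + (λ/2) ‖θ‖²` of the data `z`. -/
noncomputable def regNegLogLik {X : Type*} [MeasurableSpace X] {d n : ℕ} (ν : Measure X)
    (t : X → EuclideanSpace ℝ (Fin d)) (z : Fin n → X) (lam : ℝ)
    (θ : EuclideanSpace ℝ (Fin d)) : ℝ :=
  -(1 / (n : ℝ)) * ∑ i, Real.log (density ν t θ (z i)) + lam / 2 * ‖θ‖ ^ 2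

end ExponentialFamily

section MarkovChain

/-- The distribution `M_θ^v q` of the chain with transition kernel `x ↦ T (θ, x)`, started from
`q`, after `v` transitions. -/
noncomputable def chainLaw {X E : Type*} [MeasurableSpace X] [MeasurableSpace E]
    (T : Kernel (E × X) X) (θ : E) (v : ℕ) (q : Measure X) : Measure X :=
  (fun μ : Measure X => μ.bind (T.sectR θ))^[v] q

theorem chainLaw_succ {X E : Type*} [MeasurableSpace X] [MeasurableSpace E]
    (T : Kernel (E × X) X) (θ : E) (v : ℕ) (q : Measure X) :
    chainLaw T θ (v + 1) q = (chainLaw T θ v q).bind (T.sectR θ) := by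
  simp [chainLaw, Function.iterate_succ_apply']

instance isProbabilityMeasure_chainLaw {X E : Type*} [MeasurableSpace X] [MeasurableSpace E]
    (T : Kernel (E × X) X) [IsMarkovKernel T] (θ : E) (v : ℕ) (q : Measure X)
    [IsProbabilityMeasure q] : IsProbabilityMeasure (chainLaw T θ v q) := by
  induction v with
  | zero => simpa [chainLaw]
  | succ v ih => rw [chainLaw_succ]; infer_instance

theorem measurable_chainLaw {X E : Type*} [MeasurableSpace X] [MeasurableSpace E]
    (T : Kernel (E × X) X) [IsMarkovKernel T] (v : ℕ) (q : Measure X)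
    [IsProbabilityMeasure q] : Measurable fun θ => chainLaw T θ v q := by
  induction v with
  | zero => simp [chainLaw]
  | succ v ih =>
    let κ : Kernel E X := ⟨fun θ => chainLaw T θ v q, ih⟩
    have : IsMarkovKernel κ := ⟨fun θ => isProbabilityMeasure_chainLaw T θ v q⟩
    refine Measure.measurable_of_measurable_coe _ fun s hs => ?_
    have h : ∀ θ, chainLaw T θ (v + 1) q s = ∫⁻ x, T (θ, x) s ∂(κ θ) := fun θ => by
      rw [chainLaw_succ, Measure.bind_apply hs (T.sectR θ).aemeasurable]
      rfl
    simp_rw [h]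
    exact Measurable.lintegral_kernel_prod_right' (T.measurable_coe hs)

/-- The law of `m` independent samples from `M_θ^v r`, as a kernel in `θ`. -/
noncomputable def sampleKernel {X E : Type*} [MeasurableSpace X] [MeasurableSpace E]
    (T : Kernel (E × X) X) [IsMarkovKernel T] (v : ℕ) (r : Measure X) [IsProbabilityMeasure r]
    (m : ℕ) : Kernel E (Fin m → X) where
  toFun θ := Measure.pi fun _ => chainLaw T θ v r
  measurable' := by
    refine Measurable.measure_of_isPiSystem_of_isProbabilityMeasure generateFrom_pi.symm
      isPiSystem_pi ?_
    rintro _ ⟨s, hs, rfl⟩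
    simp_rw [Measure.pi_pi]
    exact Finset.measurable_prod _ fun i _ =>
      (Measure.measurable_coe (hs i trivial)).comp (measurable_chainLaw T v r)

end MarkovChain

section Algorithm

open Classical in
/-- The Euclidean projection `Π_Θ[φ] = argmin_{θ ∈ Θ} ‖θ - φ‖`. It exists and is unique if `Θ` is
nonempty, closed and convex (the value is `φ` if there is no closest point). -/
noncomputable def proj {d : ℕ} (Θ : Set (EuclideanSpace ℝ (Fin d)))
    (φ : EuclideanSpace ℝ (Fin d)) : EuclideanSpace ℝ (Fin d) :=
  if h : ∃ θ ∈ Θ, ∀ y ∈ Θ, ‖θ - φ‖ ≤ ‖y - φ‖ then h.choose else φ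

/-- The approximate gradient `(1/m) ∑ t(x_i) - t̄ + λ θ` computed from the samples `x`. -/
noncomputable def gradEstimate {X : Type*} {d n m : ℕ}
    (t : X → EuclideanSpace ℝ (Fin d)) (z : Fin n → X) (lam : ℝ)
    (θ : EuclideanSpace ℝ (Fin d)) (x : Fin m → X) : EuclideanSpace ℝ (Fin d) :=
  (1 / (m : ℝ)) • (∑ i, t (x i)) - dataMean t z + lam • θ

/-- One step of projected gradient descent with step size `1 / L`. -/
noncomputable def update {X : Type*} {d n m : ℕ}
    (t : X → EuclideanSpace ℝ (Fin d)) (z : Fin n → X) (lam L : ℝ)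
    (Θ : Set (EuclideanSpace ℝ (Fin d))) (θ : EuclideanSpace ℝ (Fin d)) (x : Fin m → X) :
    EuclideanSpace ℝ (Fin d) :=
  proj Θ (θ - (1 / L) • gradEstimate t z lam θ x)

/-- The law of the iterate `θ_k` of the algorithm started at `θ₀`: given `θ_{k-1}`, draw `m`
independent samples `x_1, …, x_m` from `M_{θ_{k-1}}^v r`, and update. -/
noncomputable def iterateLaw {X : Type*} [MeasurableSpace X] {d n : ℕ}
    (t : X → EuclideanSpace ℝ (Fin d)) (z : Fin n → X) (lam L : ℝ)
    (Θ : Set (EuclideanSpace ℝ (Fin d)))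
    (T : Kernel (EuclideanSpace ℝ (Fin d) × X) X) [IsMarkovKernel T]
    (r : Measure X) [IsProbabilityMeasure r] (m v : ℕ) (θ₀ : EuclideanSpace ℝ (Fin d)) :
    ℕ → Measure (EuclideanSpace ℝ (Fin d))
  | 0 => Measure.dirac θ₀
  | k + 1 =>
    (iterateLaw t z lam L Θ T r m v θ₀ k ⊗ₘ sampleKernel T v r m).map
      fun y => update t z lam L Θ y.1 y.2

end Algorithm

section Schedule

/-- `(L/λ) log (‖θ₀ - θ*‖ / (β₁ ε))`, where `D₀` stands for `‖θ₀ - θ*‖`. -/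
noncomputable def stepBound (L lam D₀ β₁ ε : ℝ) : ℝ :=
  L / lam * Real.log (D₀ / (β₁ * ε))

/-- `ℓ² R₂ / (2 ε² β₂² λ²) · (1 + √(2 log (K/δ)))²`. -/
noncomputable def sampleBound (l R₂ lam β₂ ε δ K : ℝ) : ℝ :=
  l ^ 2 * R₂ / (2 * ε ^ 2 * β₂ ^ 2 * lam ^ 2) * (1 + √(2 * Real.log (K / δ))) ^ 2

/-- `(1/(1-α)) log (2 ℓ R₂ C / (β₃ ε λ))`. -/
noncomputable def transitionBound (l R₂ lam β₃ ε C α : ℝ) : ℝ :=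
  1 / (1 - α) * Real.log (2 * l * R₂ * C / (β₃ * ε * lam))

/-- The constant `max {L, 1, √(2 R₂)}`, which equals `L` as soon as `1 ≤ L` and `2 R₂ ≤ L²`. -/
noncomputable def effLip (L R₂ : ℝ) : ℝ :=
  max L (max 1 √(2 * R₂))

end Schedule

end MCMCLearn

/-! The algorithm is projected gradient descent with step `1 / L` and a noisy gradient. The
log-partition function is convex with gradient `E_θ t`, so the ridge term makes the objective
`λ`-strongly convex, and an exact gradient step contracts distances by `1 - λ / L`
(`gradient_step_contraction`). Projection is nonexpansive and `θ*` is fixed by the exact projected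
step. Hence one actual step turns a distance `ρ` to `θ*` into at most `(1 - λ / L) ρ + e / L`, where
`e` is the distance from the sample mean of `t` to `E_θ t` (`norm_update_sub_le`).

The error `e` splits into noise (sample mean against its expectation under the chain law) and bias
(that expectation against `E_θ t`). A variance bound and McDiarmid's inequality give noise at most
`R₂ / √M * (1 + √(2 log (K / δ)))` outside an event of probability `δ / K`
(`measureReal_sampleMean_gt_le`); the bias is at most `2 R₂` times the total variation distance. The
schedule makes these at most `β₂ ε λ` and `β₃ ε λ`. Since `(1 - λ / L) b + λ b / L = b`, the errors
never accumulate beyond `b = (β₂ + β₃) ε`, while the contribution of the initial distance falls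
below `β₁ ε`. A union bound over the `K` steps (`iterateLaw_compl_le`) gives probability `1 - δ`.

The work bounds multiply the three schedule bounds, using that `sampleBound` is monotone in `K`. -/

namespace MCMCLearn

/-! ### Smooth and strongly convex functions: contraction of a gradient step. -/

section Optimization

variable {E : Type*} [NormedAddCommGroup E] [InnerProductSpace ℝ E]

/-- A differentiable function with an `L`-Lipschitz gradient lies below its quadratic upper
models. -/
theorem le_quadratic_of_lipschitz_gradient [CompleteSpace E] {f : E → ℝ} {g : E → E} {L : ℝ}
    (hg : ∀ x, HasGradientAt f (g x) x) (hL : ∀ x y, ‖g x - g y‖ ≤ L * ‖x - y‖) (x y : E) :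
    f y ≤ f x + inner ℝ (g x) (y - x) + L / 2 * ‖y - x‖ ^ 2 := by
  set u := y - x with hu
  -- Along the segment from `x` to `y`, `f` minus its quadratic model has derivative `⟪g (x + s u) -
  -- g x, u⟫ - L s ‖u‖²`, which is nonpositive for `s ≥ 0`.
  have hd : ∀ s : ℝ, HasDerivAt
      (fun s : ℝ => f (x + s • u) - s * inner ℝ (g x) u - L / 2 * s ^ 2 * ‖u‖ ^ 2)
      (inner ℝ (g (x + s • u)) u - inner ℝ (g x) u - L * s * ‖u‖ ^ 2) s := by
    intro s
    have h1 : HasDerivAt (fun s : ℝ => x + s • u) u s := by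
      simpa using ((hasDerivAt_id s).smul_const u).const_add x
    have h2 := (hg (x + s • u)).hasFDerivAt.comp_hasDerivAt s h1
    have h3 : HasDerivAt (fun s : ℝ => s * inner ℝ (g x) u) (inner ℝ (g x) u) s := by
      simpa using (hasDerivAt_id s).mul_const (inner ℝ (g x) u)
    have h4 : HasDerivAt (fun s : ℝ => L / 2 * s ^ 2 * ‖u‖ ^ 2) (L * s * ‖u‖ ^ 2) s := by
      have := (((hasDerivAt_id s).pow 2).const_mul (L / 2)).mul_const (‖u‖ ^ 2)
      refine this.congr_deriv ?_
      simp only [id_eq, Nat.cast_ofNat, Nat.add_one_sub_one, pow_one, mul_one]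
      ring
    refine ((h2.sub h3).sub h4).congr_deriv ?_
    simp [InnerProductSpace.toDual_apply_apply]
  have hanti : AntitoneOn
      (fun s : ℝ => f (x + s • u) - s * inner ℝ (g x) u - L / 2 * s ^ 2 * ‖u‖ ^ 2)
      (Set.Icc 0 1) := by
    refine antitoneOn_of_deriv_nonpos (convex_Icc 0 1)
      (fun s _ => (hd s).continuousAt.continuousWithinAt)
      (fun s _ => (hd s).differentiableAt.differentiableWithinAt) fun s hs => ?_
    rw [interior_Icc] at hs
    rw [(hd s).deriv, ← inner_sub_left]
    have h1 := real_inner_le_norm (g (x + s • u) - g x) u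
    have h2 := hL (x + s • u) x
    rw [add_sub_cancel_left, norm_smul, Real.norm_of_nonneg hs.1.le] at h2
    nlinarith [mul_le_mul_of_nonneg_right h2 (norm_nonneg u)]
  have := hanti (Set.left_mem_Icc.2 zero_le_one) (Set.right_mem_Icc.2 zero_le_one) zero_le_one
  simp only [one_smul, zero_smul, add_zero, one_mul, zero_mul, one_pow] at this
  rw [hu, add_sub_cancel] at this
  simp only [ne_eq, OfNat.ofNat_ne_zero, not_false_eq_true, zero_pow, mul_zero, zero_mul,
    sub_zero, mul_one] at this
  linarith

/-- The gradient of a convex function with quadratic upper models is cocoercive. -/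
theorem cocoercive_of_quadratic_bounds {h : E → ℝ} {g : E → E} {l : ℝ} (hl : 0 ≤ l)
    (hlow : ∀ x y, h x + inner ℝ (g x) (y - x) ≤ h y)
    (hup : ∀ x y, h y ≤ h x + inner ℝ (g x) (y - x) + l / 2 * ‖y - x‖ ^ 2) (x y : E) :
    ‖g x - g y‖ ^ 2 ≤ l * inner ℝ (g x - g y) (x - y) := by
  -- The lower model at `x` and the upper model at `y` are compared at the same point `y - s (g y -
  -- g x)`. The parameter `s` stays free so that `l = 0` can be treated too.
  have half : ∀ (s : ℝ) (x y : E), h x + inner ℝ (g x) (y - x)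
      ≤ h y + (-s + l / 2 * s ^ 2) * ‖g y - g x‖ ^ 2 := by
    intro s x y
    have h1 := hlow x (y - s • (g y - g x))
    have h2 := hup y (y - s • (g y - g x))
    have e1 : y - s • (g y - g x) - y = -(s • (g y - g x)) := by abel
    have e2 : y - s • (g y - g x) - x = (y - x) - s • (g y - g x) := by abel
    rw [e1, norm_neg, norm_smul, mul_pow, Real.norm_eq_abs, sq_abs, inner_neg_right,
      inner_smul_right] at h2
    rw [e2, inner_sub_right, inner_smul_right] at h1
    have h3 : inner ℝ (g y) (g y - g x) - inner ℝ (g x) (g y - g x) = ‖g y - g x‖ ^ 2 := by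
      rw [← inner_sub_left, real_inner_self_eq_norm_sq]
    linear_combination h1 + h2 - s * h3
  have key : ∀ s : ℝ, (2 * s - l * s ^ 2) * ‖g x - g y‖ ^ 2
      ≤ inner ℝ (g x - g y) (x - y) := by
    intro s
    have h1 := half s x y
    have h2 := half s y x
    rw [norm_sub_rev (g y) (g x)] at h1
    have h3 : inner ℝ (g x) (y - x) = - inner ℝ (g x) (x - y) := by
      rw [← inner_neg_right, neg_sub]
    rw [inner_sub_left]
    linarith
  -- For `l = 0` (the case `lam = L` below) the bound `key` is linear in `s`, so `‖g x - g y‖` must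
  -- vanish; for `l > 0` the best choice is `s = 1 / l`.
  rcases hl.eq_or_lt with rfl | hl
  · by_contra! hc
    rw [zero_mul] at hc
    generalize ‖g x - g y‖ ^ 2 = N at key hc
    have := key ((inner ℝ (g x - g y) (x - y) + 1) / (2 * N))
    have e : 2 * ((inner ℝ (g x - g y) (x - y) + 1) / (2 * N)) * N
        = inner ℝ (g x - g y) (x - y) + 1 := by field_simp
    rw [zero_mul, sub_zero, e] at this
    linarith
  · have := key (1 / l)
    field_simp at this
    linarith

/-- A gradient step of length `1 / L` for a `lam`-strongly convex function with quadratic upper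
models of curvature `L` is a contraction with factor `1 - lam / L`. -/
theorem gradient_step_contraction {f : E → ℝ} {g : E → E} {lam L : ℝ} (hL : 0 < L)
    (hle : lam ≤ L)
    (hlow : ∀ x y, f x + inner ℝ (g x) (y - x) + lam / 2 * ‖y - x‖ ^ 2 ≤ f y)
    (hup : ∀ x y, f y ≤ f x + inner ℝ (g x) (y - x) + L / 2 * ‖y - x‖ ^ 2) (x y : E) :
    ‖(x - (1 / L) • g x) - (y - (1 / L) • g y)‖ ≤ (1 - lam / L) * ‖x - y‖ := by
  have hsq : ∀ x y : E, lam / 2 * ‖y‖ ^ 2 - lam / 2 * ‖x‖ ^ 2 - lam * inner ℝ x (y - x)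
      = lam / 2 * ‖y - x‖ ^ 2 := by
    intro x y
    rw [@norm_sub_sq_real, inner_sub_right, real_inner_self_eq_norm_sq, real_inner_comm]
    ring
  -- Removing the quadratic part leaves a convex function whose upper models have curvature `L -
  -- lam`.
  have hco := cocoercive_of_quadratic_bounds (h := fun z => f z - lam / 2 * ‖z‖ ^ 2)
    (g := fun z => g z - lam • z) (sub_nonneg.2 hle)
    (fun x y => by
      have := hlow x y
      have := hsq x y
      rw [inner_sub_left, real_inner_smul_left]
      linarith)
    (fun x y => by
      have := hup x y
      have := hsq x y
      rw [inner_sub_left, real_inner_smul_left]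
      linarith) x y
  set D := g x - lam • x - (g y - lam • y) with hD
  set w := x - y with hw
  have e : (x - (1 / L) • g x) - (y - (1 / L) • g y) = (1 - lam / L) • w - (1 / L) • D := by
    rw [hD, hw]
    module
  have hc : 0 ≤ 1 - lam / L := by rw [sub_nonneg, div_le_one hL]; exact hle
  rw [e]
  refine abs_le_of_sq_le_sq' ?_ (by positivity) |>.2
  rw [@norm_sub_sq_real, norm_smul, norm_smul, real_inner_smul_left, real_inner_smul_right,
    Real.norm_of_nonneg hc, Real.norm_of_nonneg (by positivity : 0 ≤ 1 / L), real_inner_comm]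
  -- In the expanded square the cross term is `-2Q` with `Q = (1 / L)² (L - lam) ⟪D, w⟫`, and
  -- cocoercivity bounds the `‖D‖²` term by `Q`. As `Q ≥ 0`, only the contracted `w` term remains.
  have hinner : 0 ≤ (L - lam) * inner ℝ D w := le_trans (sq_nonneg _) hco
  have h1 : (1 / L) ^ 2 * ‖D‖ ^ 2 ≤ (1 / L) ^ 2 * ((L - lam) * inner ℝ D w) :=
    mul_le_mul_of_nonneg_left hco (sq_nonneg _)
  have h2 : (1 - lam / L) * (1 / L * inner ℝ D w) = (1 / L) ^ 2 * ((L - lam) * inner ℝ D w) := by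
    field_simp
  have h3 : 0 ≤ (1 / L) ^ 2 * ((L - lam) * inner ℝ D w) := mul_nonneg (sq_nonneg _) hinner
  rw [mul_pow, mul_pow, h2]
  linarith

/-- By convexity `y - x` is a feasible direction at `x`. This replaces a vanishing gradient at a
constrained minimizer. -/
theorem inner_gradient_nonneg_of_isMinOn [CompleteSpace E] {f : E → ℝ} {g x : E} {s : Set E}
    (hg : HasGradientAt f g x) (hs : Convex ℝ s) (hx : x ∈ s) (hmin : IsMinOn f s x) {y : E}
    (hy : y ∈ s) : 0 ≤ inner ℝ g (y - x) := by
  have h := hmin.localize.hasFDerivWithinAt_nonneg (y := y - x)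
    hg.hasFDerivAt.hasFDerivWithinAt
    (sub_mem_posTangentConeAt_of_segment_subset (hs.segment_subset hx hy))
  simpa using h

end Optimization

/-! ### Euclidean projection onto a closed convex set. -/

section Projection

variable {d : ℕ} {Θ : Set (EuclideanSpace ℝ (Fin d))}

theorem proj_spec (hc : IsClosed Θ) (hconv : Convex ℝ Θ) (hne : Θ.Nonempty)
    (φ : EuclideanSpace ℝ (Fin d)) :
    proj Θ φ ∈ Θ ∧ ∀ w ∈ Θ, inner ℝ (φ - proj Θ φ) (w - proj Θ φ) ≤ 0 := by
  have hex : ∃ θ ∈ Θ, ∀ y ∈ Θ, ‖θ - φ‖ ≤ ‖y - φ‖ := by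
    obtain ⟨v, hv, hv'⟩ := hc.exists_infDist_eq_dist hne φ
    refine ⟨v, hv, fun y hy => ?_⟩
    rw [← dist_eq_norm, ← dist_eq_norm, dist_comm, ← hv', dist_comm]
    exact Metric.infDist_le_dist_of_mem hy
  have hp : proj Θ φ = hex.choose := by rw [proj, dif_pos hex]
  obtain ⟨hmem, hle⟩ := hex.choose_spec
  rw [← hp] at hmem hle
  refine ⟨hmem, (norm_eq_iInf_iff_real_inner_le_zero hconv hmem).1 ?_⟩
  have : Nonempty Θ := ⟨⟨_, hmem⟩⟩
  refine le_antisymm (le_ciInf fun w => ?_) (ciInf_le ⟨0, ?_⟩ (⟨_, hmem⟩ : Θ))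
  · rw [norm_sub_rev, norm_sub_rev φ]
    exact hle w w.2
  · rintro _ ⟨w, rfl⟩
    exact norm_nonneg _

/-- Adding the obtuse-angle inequalities at the two projections gives `‖a - b‖² ≤ ⟪φ - ψ, a - b⟫`;
Cauchy–Schwarz finishes. -/
theorem norm_proj_sub_proj_le (hc : IsClosed Θ) (hconv : Convex ℝ Θ) (hne : Θ.Nonempty)
    (φ ψ : EuclideanSpace ℝ (Fin d)) : ‖proj Θ φ - proj Θ ψ‖ ≤ ‖φ - ψ‖ := by
  obtain ⟨hφ, hφ'⟩ := proj_spec hc hconv hne φ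
  obtain ⟨hψ, hψ'⟩ := proj_spec hc hconv hne ψ
  have h1 := hφ' _ hψ
  have h2 := hψ' _ hφ
  set a := proj Θ φ
  set b := proj Θ ψ
  have h3 : ‖a - b‖ ^ 2 ≤ inner ℝ (φ - ψ) (a - b) := by
    have e1 : φ - ψ = (φ - a) - (ψ - b) + (a - b) := by abel
    have e2 : inner ℝ (φ - a) (b - a) = - inner ℝ (φ - a) (a - b) := by
      rw [← inner_neg_right, neg_sub]
    rw [e1, inner_add_left, inner_sub_left, real_inner_self_eq_norm_sq]
    linarith
  have h4 := h3.trans (real_inner_le_norm _ _)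
  rcases (norm_nonneg (a - b)).eq_or_lt with h | h
  · rw [← h]
    exact norm_nonneg _
  · rw [sq] at h4
    exact le_of_mul_le_mul_right h4 h

theorem continuous_proj (hc : IsClosed Θ) (hconv : Convex ℝ Θ) (hne : Θ.Nonempty) :
    Continuous (proj Θ) := by
  refine LipschitzWith.continuous (K := 1) (LipschitzWith.of_dist_le_mul fun φ ψ => ?_)
  simpa [dist_eq_norm] using norm_proj_sub_proj_le hc hconv hne φ ψ

/-- The obtuse-angle condition has only one solution: adding it for two solutions makes their
squared distance nonpositive. It serves to recognize `θ*` as a fixed point. -/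
theorem proj_eq_of_inner_nonpos (hc : IsClosed Θ) (hconv : Convex ℝ Θ)
    {φ θ : EuclideanSpace ℝ (Fin d)} (hθ : θ ∈ Θ)
    (h : ∀ w ∈ Θ, inner ℝ (φ - θ) (w - θ) ≤ 0) : proj Θ φ = θ := by
  obtain ⟨hφ, hφ'⟩ := proj_spec hc hconv ⟨θ, hθ⟩ φ
  have h1 := h _ hφ
  have h2 := hφ' _ hθ
  set a := proj Θ φ
  have h3 : ‖a - θ‖ ^ 2 ≤ 0 := by
    rw [← real_inner_self_eq_norm_sq]
    have e1 : a - θ = (φ - θ) - (φ - a) := by abel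
    have e2 : inner ℝ (φ - a) (θ - a) = - inner ℝ (φ - a) (a - θ) := by
      rw [← inner_neg_right, neg_sub]
    nth_rw 1 [e1]
    rw [inner_sub_left]
    linarith
  rw [← sub_eq_zero, ← norm_eq_zero]
  exact pow_eq_zero_iff two_ne_zero |>.1 (le_antisymm h3 (sq_nonneg _))

end Projection

/-! ### Concentration of sample means of bounded vectors. -/

section Concentration

variable {X : Type*} [MeasurableSpace X]

theorem integrable_of_abs_le {μ : Measure X} [IsFiniteMeasure μ] {f : X → ℝ}
    (hf : Measurable f) {B : ℝ} (hB : ∀ x, |f x| ≤ B) : Integrable f μ :=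
  .of_bound hf.aestronglyMeasurable B (Filter.Eventually.of_forall hB)

theorem abs_integral_le_of_abs_le {μ : Measure X} [IsProbabilityMeasure μ] {f : X → ℝ} {B : ℝ}
    (hB : ∀ x, |f x| ≤ B) : |∫ x, f x ∂μ| ≤ B := by
  simpa using norm_integral_le_of_norm_le_const (μ := μ) (f := f)
    (Filter.Eventually.of_forall hB)

theorem integrable_exp_mul_sub {μ : Measure X} [IsFiniteMeasure μ] {f : X → ℝ}
    (hf : Measurable f) {B : ℝ} (hB : ∀ x, |f x| ≤ B) (s a : ℝ) :
    Integrable (fun x => Real.exp (s * (f x - a))) μ := by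
  refine integrable_of_abs_le (by fun_prop) (B := Real.exp (|s| * (B + |a|))) fun x => ?_
  rw [Real.abs_exp, Real.exp_le_exp]
  refine (le_abs_self _).trans ?_
  rw [abs_mul]
  exact mul_le_mul_of_nonneg_left ((abs_sub _ _).trans (by have := hB x; linarith))
    (abs_nonneg _)

/-- Hoeffding's lemma in terms of the oscillation. -/
theorem integral_exp_le_of_oscillation (P : Measure X) [IsProbabilityMeasure P] {g : X → ℝ}
    (hg : Measurable g) {c : ℝ} (hc : ∀ a b, |g a - g b| ≤ c) (s : ℝ) :
    ∫ x, Real.exp (s * (g x - ∫ y, g y ∂P)) ∂P ≤ Real.exp (c ^ 2 * s ^ 2 / 8) := by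
  have hne : Nonempty X := P.nonempty_of_neZero
  obtain ⟨x₀⟩ := hne
  have hbdd : BddBelow (Set.range g) := by
    refine ⟨g x₀ - c, ?_⟩
    rintro _ ⟨y, rfl⟩
    have := (abs_le.1 (hc x₀ y)).2
    linarith
  have hmem : ∀ x, g x ∈ Set.Icc (⨅ y, g y) ((⨅ y, g y) + c) := by
    intro x
    refine ⟨ciInf_le hbdd x, ?_⟩
    have : g x - c ≤ ⨅ y, g y := by
      have : Nonempty X := ⟨x₀⟩
      refine le_ciInf fun y => ?_
      have := (abs_le.1 (hc x y)).2
      linarith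
    linarith
  have h := (hasSubgaussianMGF_of_mem_Icc (μ := P) hg.aemeasurable
    (Filter.Eventually.of_forall hmem)).mgf_le s
  refine h.trans (le_of_eq ?_)
  congr 1
  simp only [add_sub_cancel_left, NNReal.coe_pow, NNReal.coe_div, coe_nnnorm, Real.norm_eq_abs,
    NNReal.coe_ofNat, div_pow, sq_abs]
  ring

/-- The moment generating function bound behind McDiarmid's inequality. -/
theorem integral_exp_le_of_bounded_differences (P : Measure X) [IsProbabilityMeasure P]
    {c B : ℝ} (s : ℝ) (m : ℕ) (F : (Fin m → X) → ℝ) (hF : Measurable F) (hB : ∀ x, |F x| ≤ B)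
    (hc : ∀ x i a, |F (Function.update x i a) - F x| ≤ c) :
    ∫ x, Real.exp (s * (F x - ∫ y, F y ∂(Measure.pi fun _ => P))) ∂(Measure.pi fun _ => P)
      ≤ Real.exp (m * (c ^ 2 * s ^ 2 / 8)) := by
  induction m with
  | zero =>
    have h : ∀ x : Fin 0 → X, F x = F default := fun x => congrArg F (Subsingleton.elim _ _)
    simp [h]
  | succ m ih =>
    set Q : Measure (Fin m → X) := Measure.pi fun _ => P with hQ
    let e := MeasurableEquiv.piFinSuccAbove (fun _ : Fin (m + 1) => X) 0
    have he : MeasurePreserving e (Measure.pi fun _ => P) (P.prod Q) :=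
      measurePreserving_piFinSuccAbove (fun _ : Fin (m + 1) => P) 0
    -- The first coordinate is split off. Given its value `a`, the fluctuation around the
    -- conditional mean `g a` is handled by induction, and that of `g` itself by Hoeffding's lemma.
    let G : X → (Fin m → X) → ℝ := fun a x => F (Fin.cons a x)
    have heF : ∀ x, F x = G (e x).1 (e x).2 := by
      intro x
      simp only [G]
      congr 1
      exact (Fin.cons_self_tail x).symm
    have hcons : Measurable fun y : X × (Fin m → X) => (Fin.cons y.1 y.2 : Fin (m + 1) → X) := by
      refine measurable_pi_iff.2 (Fin.forall_fin_succ.2 ⟨?_, fun i => ?_⟩)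
      · simpa using measurable_fst
      · simp only [Fin.cons_succ]
        fun_prop
    have hG : Measurable fun y : X × (Fin m → X) => G y.1 y.2 := hF.comp hcons
    have hGa : ∀ a, Measurable (G a) := fun a => hG.comp measurable_prodMk_left
    have hGB : ∀ a x, |G a x| ≤ B := fun a x => hB _
    have hGc : ∀ a x i b, |G a (Function.update x i b) - G a x| ≤ c := by
      intro a x i b
      have := hc (Fin.cons a x) i.succ b
      rwa [← Fin.cons_update] at this
    let g : X → ℝ := fun a => ∫ x, G a x ∂Q
    have hg : Measurable g := hG.stronglyMeasurable.integral_prod_right'.measurable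
    have hgB : ∀ a, |g a| ≤ B := fun a => abs_integral_le_of_abs_le (hGB a)
    have hgc : ∀ a b, |g a - g b| ≤ c := by
      intro a b
      have h1 : g a - g b = ∫ x, (G a x - G b x) ∂Q :=
        (integral_sub (integrable_of_abs_le (hGa a) (hGB a))
          (integrable_of_abs_le (hGa b) (hGB b))).symm
      rw [h1]
      refine abs_integral_le_of_abs_le fun x => ?_
      have := hc (Fin.cons b x) 0 a
      rwa [Fin.update_cons_zero] at this
    have hmean : ∫ y, F y ∂(Measure.pi fun _ => P) = ∫ a, g a ∂P := by
      simp_rw [heF]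
      rw [he.integral_comp e.measurableEmbedding (fun y => G y.1 y.2)]
      exact integral_prod _ (integrable_of_abs_le hG fun y => hGB _ _)
    rw [hmean]
    set E := ∫ a, g a ∂P
    have hexp : ∫ x, Real.exp (s * (F x - E)) ∂(Measure.pi fun _ => P)
        = ∫ a, ∫ x, Real.exp (s * (G a x - E)) ∂Q ∂P := by
      simp_rw [heF]
      rw [he.integral_comp e.measurableEmbedding (fun y => Real.exp (s * (G y.1 y.2 - E)))]
      exact integral_prod _ (integrable_exp_mul_sub hG (fun y => hGB _ _) s E)
    rw [hexp]
    have hin : ∀ a, ∫ x, Real.exp (s * (G a x - E)) ∂Q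
        ≤ Real.exp (m * (c ^ 2 * s ^ 2 / 8)) * Real.exp (s * (g a - E)) := by
      intro a
      have h1 : ∀ x, Real.exp (s * (G a x - E))
          = Real.exp (s * (G a x - g a)) * Real.exp (s * (g a - E)) := by
        intro x
        rw [← Real.exp_add]
        congr 1
        ring
      simp_rw [h1]
      rw [integral_mul_const]
      exact mul_le_mul_of_nonneg_right (ih (G a) (hGa a) (hGB a) (hGc a)) (Real.exp_pos _).le
    refine (integral_mono_of_nonneg (Filter.Eventually.of_forall fun a => ?_)
      ((integrable_exp_mul_sub hg hgB s E).const_mul _)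
      (Filter.Eventually.of_forall hin)).trans ?_
    · exact integral_nonneg fun x => (Real.exp_pos _).le
    rw [integral_const_mul]
    refine (mul_le_mul_of_nonneg_left (integral_exp_le_of_oscillation P hg hgc s)
      (Real.exp_pos _).le).trans (le_of_eq ?_)
    rw [← Real.exp_add]
    congr 1
    push_cast
    ring

/-- **McDiarmid's inequality** for bounded functions of independent, identically distributed
variables. -/
theorem measureReal_ge_le_of_bounded_differences (P : Measure X) [IsProbabilityMeasure P]
    {c B : ℝ} {m : ℕ} (F : (Fin m → X) → ℝ) (hF : Measurable F) (hB : ∀ x, |F x| ≤ B)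
    (hc : ∀ x i a, |F (Function.update x i a) - F x| ≤ c) {u : ℝ} (hu : 0 ≤ u)
    (hmc : 0 < m * c ^ 2) :
    (Measure.pi fun _ => P).real {x | (∫ y, F y ∂(Measure.pi fun _ => P)) + u ≤ F x}
      ≤ Real.exp (-(2 * u ^ 2 / (m * c ^ 2))) := by
  set Q : Measure (Fin m → X) := Measure.pi fun _ => P
  set E := ∫ y, F y ∂Q
  -- Chernoff's bound; this `t` minimizes `m c² t² / 8 - t u`.
  have h := measure_ge_le_exp_mul_mgf (μ := Q) (X := fun x => F x - E) (t := 4 * u / (m * c ^ 2))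
    u (by positivity) (integrable_exp_mul_sub hF hB _ _)
  have hset : {x | E + u ≤ F x} = {x | u ≤ F x - E} := by
    ext x
    simp only [Set.mem_ofPred_eq]
    constructor <;> intro h <;> linarith
  rw [hset]
  refine h.trans ((mul_le_mul_of_nonneg_left
    (integral_exp_le_of_bounded_differences P _ m F hF hB hc) (Real.exp_pos _).le).trans
      (le_of_eq ?_))
  rw [← Real.exp_add]
  congr 1
  generalize (m : ℝ) = k at *
  have : k ≠ 0 := by rintro rfl; simp at hmc
  have : c ≠ 0 := by rintro rfl; simp at hmc
  field_simp
  ring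

variable {d : ℕ} {t : X → EuclideanSpace ℝ (Fin d)} {R : ℝ}

theorem integrable_of_norm_le {μ : Measure X} [IsFiniteMeasure μ] (ht : Measurable t)
    (hR : ∀ x, ‖t x‖ ≤ R) : Integrable t μ :=
  .of_bound ht.aestronglyMeasurable R (Filter.Eventually.of_forall hR)

theorem norm_sampleMean_sub_le (P : Measure X) [IsProbabilityMeasure P]
    (hR : ∀ x, ‖t x‖ ≤ R) {m : ℕ} (hm : 0 < m) (x : Fin m → X) :
    ‖(1 / (m : ℝ)) • (∑ i, t (x i)) - ∫ y, t y ∂P‖ ≤ 2 * R := by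
  have h1 : ‖∑ i, t (x i)‖ ≤ m * R :=
    (norm_sum_le _ _).trans ((Finset.sum_le_sum fun i _ => hR (x i)).trans (by simp))
  have h2 : ‖∫ y, t y ∂P‖ ≤ R := by
    simpa using norm_integral_le_of_norm_le_const (μ := P) (Filter.Eventually.of_forall hR)
  have h3 : ‖(1 / (m : ℝ)) • (∑ i, t (x i))‖ ≤ R := by
    rw [norm_smul, Real.norm_of_nonneg (by positivity), one_div, inv_mul_le_iff₀ (by positivity)]
    exact h1
  exact (norm_sub_le _ _).trans (by linarith)

/-- The mean square deviation of the sample mean of a bounded random vector. -/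
theorem integral_norm_sq_sampleMean_le (P : Measure X) [IsProbabilityMeasure P]
    (ht : Measurable t) (hR : ∀ x, ‖t x‖ ≤ R) {m : ℕ} (hm : 0 < m) :
    ∫ x : Fin m → X, ‖(1 / (m : ℝ)) • (∑ i, t (x i)) - ∫ y, t y ∂P‖ ^ 2
      ∂(Measure.pi fun _ => P) ≤ R ^ 2 / m := by
  set Q : Measure (Fin m → X) := Measure.pi fun _ => P
  have hm' : (m : ℝ) ≠ 0 := by positivity
  have hti := integrable_of_norm_le (μ := P) ht hR
  have htj : ∀ j, Measurable fun x => t x j := fun j => by fun_prop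
  have htjR : ∀ j x, |t x j| ≤ R := fun j x => (PiLp.norm_apply_le (t x) j).trans (hR x)
  have hmem : ∀ j, MemLp (fun x => t x j) 2 P := fun j =>
    .of_bound (htj j).aestronglyMeasurable R (Filter.Eventually.of_forall (htjR j))
  have hcoord : ∀ j, (∫ y, t y ∂P) j = ∫ y, t y j ∂P := fun j =>
    ((EuclideanSpace.proj (𝕜 := ℝ) j).integral_comp_comm hti).symm
  have hmemQ : ∀ j i, MemLp (fun x : Fin m → X => t (x i) j) 2 Q := fun j i =>
    (hmem j).comp_measurePreserving (measurePreserving_eval _ i)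
  have hint : ∀ j i, ∫ x : Fin m → X, t (x i) j ∂Q = ∫ y, t y j ∂P := by
    intro j i
    have hp := measurePreserving_eval (fun _ : Fin m => P) i
    rw [← hp.map_eq, integral_map hp.measurable.aemeasurable
      (htj j).aestronglyMeasurable]
  have hvar : ∀ j, ∫ x : Fin m → X, ((1 / (m : ℝ)) * (∑ i, t (x i) j) - ∫ y, t y j ∂P) ^ 2 ∂Q
      = 1 / m * Var[fun x => t x j; P] := by
    intro j
    have h1 := variance_sum_pi (μ := fun _ : Fin m => P) (X := fun _ x => t x j)
      (fun _ => hmem j)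
    have h2 : (∑ i : Fin m, fun ω : Fin m → X => t (ω i) j) = fun ω => ∑ i, t (ω i) j := by
      ext ω
      simp
    rw [h2, Finset.sum_const, Finset.card_univ, Fintype.card_fin, nsmul_eq_mul,
      variance_eq_integral (memLp_finsetSum _ fun i _ => hmemQ j i).aestronglyMeasurable.aemeasurable]
      at h1
    rw [integral_finsetSum _ (fun i _ => (hmemQ j i).integrable (by norm_num))] at h1
    simp_rw [hint, Finset.sum_const, Finset.card_univ, Fintype.card_fin, nsmul_eq_mul] at h1
    have h3 : ∀ x : Fin m → X, ((1 / (m : ℝ)) * (∑ i, t (x i) j) - ∫ y, t y j ∂P) ^ 2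
        = (1 / m) ^ 2 * (∑ i, t (x i) j - m * ∫ y, t y j ∂P) ^ 2 := by
      intro x
      field_simp
    simp_rw [h3]
    rw [integral_const_mul, h1]
    field_simp
  have hsq : ∀ x : Fin m → X, ‖(1 / (m : ℝ)) • (∑ i, t (x i)) - ∫ y, t y ∂P‖ ^ 2
      = ∑ j, ((1 / (m : ℝ)) * (∑ i, t (x i) j) - ∫ y, t y j ∂P) ^ 2 := by
    intro x
    rw [EuclideanSpace.real_norm_sq_eq]
    refine Finset.sum_congr rfl fun j _ => ?_
    rw [← hcoord]
    simp
  simp_rw [hsq]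
  rw [integral_finsetSum]
  · simp_rw [hvar]
    -- The coordinate second moments sum to `E ‖t‖² ≤ R²`, so no dimension factor appears.
    have h1 : ∀ j, Var[fun x => t x j; P] ≤ ∫ x, (t x j) ^ 2 ∂P := fun j =>
      variance_le_expectation_sq (htj j).aestronglyMeasurable
    have h2 : ∑ j, ∫ x, (t x j) ^ 2 ∂P ≤ R ^ 2 := by
      rw [← integral_finsetSum _ fun j _ => (hmem j).integrable_sq]
      refine (le_abs_self _).trans (abs_integral_le_of_abs_le fun x => ?_)
      rw [← EuclideanSpace.real_norm_sq_eq, abs_of_nonneg (sq_nonneg _)]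
      exact pow_le_pow_left₀ (norm_nonneg _) (hR x) 2
    rw [← Finset.mul_sum]
    calc 1 / (m : ℝ) * ∑ j, Var[fun x => t x j; P] ≤ 1 / m * R ^ 2 :=
          mul_le_mul_of_nonneg_left ((Finset.sum_le_sum fun j _ => h1 j).trans h2) (by positivity)
      _ = R ^ 2 / m := by ring
  · intro j _
    exact (((memLp_finsetSum _ fun i _ => hmemQ j i).const_mul (1 / (m : ℝ))).sub
      (memLp_const _)).integrable_sq

/-- Jensen's inequality for the square, in the form that a variance is nonnegative. -/
theorem integral_norm_sampleMean_le (P : Measure X) [IsProbabilityMeasure P]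
    (ht : Measurable t) (hR : ∀ x, ‖t x‖ ≤ R) {m : ℕ} (hm : 0 < m) :
    ∫ x : Fin m → X, ‖(1 / (m : ℝ)) • (∑ i, t (x i)) - ∫ y, t y ∂P‖
      ∂(Measure.pi fun _ => P) ≤ R / √m := by
  obtain ⟨x₀⟩ := P.nonempty_of_neZero
  have hR0 : 0 ≤ R := (norm_nonneg _).trans (hR x₀)
  set Q : Measure (Fin m → X) := Measure.pi fun _ => P
  have hmeas : Measurable fun x : Fin m → X =>
      ‖(1 / (m : ℝ)) • (∑ i, t (x i)) - ∫ y, t y ∂P‖ := by fun_prop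
  have hbd : ∀ x : Fin m → X, ‖(1 / (m : ℝ)) • (∑ i, t (x i)) - ∫ y, t y ∂P‖ ≤ 2 * R :=
    fun x => norm_sampleMean_sub_le P hR hm x
  have hmem : MemLp (fun x : Fin m → X =>
      ‖(1 / (m : ℝ)) • (∑ i, t (x i)) - ∫ y, t y ∂P‖) 2 Q :=
    .of_bound hmeas.aestronglyMeasurable (2 * R)
      (Filter.Eventually.of_forall fun x => by simpa using hbd x)
  have h1 := variance_nonneg (fun x : Fin m → X =>
    ‖(1 / (m : ℝ)) • (∑ i, t (x i)) - ∫ y, t y ∂P‖) Q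
  rw [variance_eq_sub hmem] at h1
  have h2 := integral_norm_sq_sampleMean_le P ht hR hm
  refine abs_le_of_sq_le_sq' ?_ (by positivity) |>.2
  rw [div_pow, Real.sq_sqrt (by positivity)]
  refine le_trans ?_ h2
  simpa using h1

/-- The deviation of the sample mean of a bounded random vector exceeds
`R / √m * (1 + √(2 log (1/p)))` with probability at most `p`. -/
theorem measureReal_sampleMean_gt_le (P : Measure X) [IsProbabilityMeasure P]
    (ht : Measurable t) (hR : ∀ x, ‖t x‖ ≤ R) {m : ℕ} (hm : 0 < m) {p : ℝ} (hp : 0 < p)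
    (hp1 : p ≤ 1) :
    (Measure.pi fun _ => P).real {x : Fin m → X | R / √m * (1 + √(2 * Real.log (1 / p))) <
      ‖(1 / (m : ℝ)) • (∑ i, t (x i)) - ∫ y, t y ∂P‖} ≤ p := by
  obtain ⟨x₀⟩ := P.nonempty_of_neZero
  have hR0 : 0 ≤ R := (norm_nonneg _).trans (hR x₀)
  set Q : Measure (Fin m → X) := Measure.pi fun _ => P
  have hbd : ∀ x : Fin m → X, ‖(1 / (m : ℝ)) • (∑ i, t (x i)) - ∫ y, t y ∂P‖ ≤ 2 * R :=
    fun x => norm_sampleMean_sub_le P hR hm x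
  -- For `R = 0` the difference constant `2 R / m` vanishes and McDiarmid's inequality does not
  -- apply, but then there is no deviation at all.
  rcases hR0.eq_or_lt with rfl | hR0
  · have : {x : Fin m → X | 0 / √m * (1 + √(2 * Real.log (1 / p))) <
        ‖(1 / (m : ℝ)) • (∑ i, t (x i)) - ∫ y, t y ∂P‖} = ∅ := by
      ext x
      simpa using hbd x
    rw [this, measureReal_empty]
    exact hp.le
  have hm0 : (0 : ℝ) < m := by positivity
  have hlog : 0 ≤ Real.log (1 / p) := Real.log_nonneg (by rw [le_div_iff₀ hp]; linarith)
  have h := measureReal_ge_le_of_bounded_differences P (c := 2 * R / m) (B := 2 * R)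
    (fun x : Fin m → X => ‖(1 / (m : ℝ)) • (∑ i, t (x i)) - ∫ y, t y ∂P‖)
    (by fun_prop) (fun x => by simpa using hbd x)
    (fun x i a => ?_) (u := R / √m * √(2 * Real.log (1 / p))) (by positivity) (by positivity)
  · refine (measureReal_mono fun x hx => ?_).trans (h.trans (le_of_eq ?_))
    · have hmean := integral_norm_sampleMean_le P ht hR hm
      simp only [Set.mem_ofPred_eq] at hx ⊢
      linarith
    · have e : 2 * (R / √m * √(2 * Real.log (1 / p))) ^ 2 / (m * (2 * R / m) ^ 2)
          = Real.log (1 / p) := by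
        rw [mul_pow, div_pow, Real.sq_sqrt hm0.le, Real.sq_sqrt (by positivity)]
        field_simp
      rw [e, one_div, Real.log_inv, neg_neg, Real.exp_log hp]
  · refine (abs_norm_sub_norm_le _ _).trans ?_
    have hsum : ∑ k, t (Function.update x i a k) - ∑ k, t (x k) = t a - t (x i) := by
      rw [← Finset.sum_sub_distrib, Finset.sum_eq_single i]
      · simp
      · intro k _ hk
        simp [Function.update_of_ne hk]
      · simp
    rw [sub_sub_sub_cancel_right, ← smul_sub, hsum, norm_smul,
      Real.norm_of_nonneg (by positivity)]
    have := (norm_sub_le (t a) (t (x i))).trans (add_le_add (hR a) (hR (x i)))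
    calc 1 / (m : ℝ) * ‖t a - t (x i)‖ ≤ 1 / m * (R + R) :=
          mul_le_mul_of_nonneg_left this (by positivity)
      _ = 2 * R / m := by ring

end Concentration

/-! ### Gradient and convexity of the log-partition function and of the objective. -/

section ExponentialFamilyCalculus

theorem regNegLogLik_eq {X : Type*} [MeasurableSpace X] {d n : ℕ} {ν : Measure X}
    {t : X → EuclideanSpace ℝ (Fin d)} (hn : 0 < n) (z : Fin n → X) (lam : ℝ)
    (θ : EuclideanSpace ℝ (Fin d)) :
    regNegLogLik ν t z lam θ
      = logPartition ν t θ - inner ℝ (dataMean t z) θ + lam / 2 * ‖θ‖ ^ 2 := by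
  have hn' : (n : ℝ) ≠ 0 := by positivity
  simp only [regNegLogLik, density, Real.log_exp, dataMean, Finset.sum_sub_distrib,
    real_inner_smul_left, sum_inner, Finset.sum_const, Finset.card_univ, Fintype.card_fin,
    nsmul_eq_mul]
  simp_rw [real_inner_comm θ]
  field_simp
  ring

variable {X : Type*} [MeasurableSpace X] {d n : ℕ} {ν : Measure X} [IsFiniteMeasure ν]
  {t : X → EuclideanSpace ℝ (Fin d)} {R : ℝ}

theorem integrable_exp_inner (ht : Measurable t) (hR : ∀ x, ‖t x‖ ≤ R)
    (θ : EuclideanSpace ℝ (Fin d)) :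
    Integrable (fun x => Real.exp (inner ℝ θ (t x))) ν := by
  refine integrable_of_abs_le (by fun_prop) (B := Real.exp (‖θ‖ * R)) fun x => ?_
  rw [Real.abs_exp, Real.exp_le_exp]
  exact (real_inner_le_norm _ _).trans (mul_le_mul_of_nonneg_left (hR x) (norm_nonneg _))

theorem expFamily_eq_tilted [NeZero ν] (ht : Measurable t) (hR : ∀ x, ‖t x‖ ≤ R)
    (θ : EuclideanSpace ℝ (Fin d)) :
    expFamily ν t θ = ν.tilted fun x => inner ℝ θ (t x) := by
  have hpos := integral_exp_pos (integrable_exp_inner (ν := ν) ht hR θ)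
  simp only [expFamily, Measure.tilted, density, logPartition, Real.exp_sub, Real.exp_log hpos]

theorem isProbabilityMeasure_expFamily [NeZero ν] (ht : Measurable t) (hR : ∀ x, ‖t x‖ ≤ R)
    (θ : EuclideanSpace ℝ (Fin d)) : IsProbabilityMeasure (expFamily ν t θ) := by
  rw [expFamily_eq_tilted ht hR]
  exact isProbabilityMeasure_tilted (integrable_exp_inner ht hR θ)

/-- The gradient of the log-partition function is the mean of the sufficient statistics. -/
theorem hasGradientAt_logPartition [NeZero ν] (ht : Measurable t) (hR : ∀ x, ‖t x‖ ≤ R)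
    (θ : EuclideanSpace ℝ (Fin d)) :
    HasGradientAt (logPartition ν t) (∫ x, t x ∂(expFamily ν t θ)) θ := by
  have hpos := integral_exp_pos (integrable_exp_inner (ν := ν) ht hR θ)
  have hmeas : ∀ φ : EuclideanSpace ℝ (Fin d), AEStronglyMeasurable
      (fun x => Real.exp (inner ℝ φ (t x))) ν := fun φ => (integrable_exp_inner ht hR φ).1
  have hmeas' : Measurable fun x => Real.exp (inner ℝ θ (t x)) • innerSL ℝ (t x) := by
    have h1 : Measurable fun x => Real.exp (inner ℝ θ (t x)) := by fun_prop
    exact h1.smul ((innerSL ℝ).continuous.measurable.comp ht)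
  -- A dominating constant on the unit ball around `θ` permits differentiation under the integral.
  have hbound : ∀ x, ∀ φ ∈ Metric.ball θ 1,
      ‖Real.exp (inner ℝ φ (t x)) • innerSL ℝ (t x)‖ ≤ Real.exp ((‖θ‖ + 1) * R) * R := by
    intro x φ hφ
    rw [norm_smul, Real.norm_of_nonneg (Real.exp_pos _).le, innerSL_apply_norm]
    have hφ' : ‖φ‖ ≤ ‖θ‖ + 1 := by
      have h1 := norm_le_norm_add_norm_sub' φ θ
      rw [Metric.mem_ball, dist_eq_norm] at hφ
      linarith
    refine mul_le_mul (Real.exp_le_exp.2 ((real_inner_le_norm _ _).trans ?_)) (hR x)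
      (norm_nonneg _) (Real.exp_pos _).le
    exact mul_le_mul hφ' (hR x) (norm_nonneg _) (by positivity)
  have hI : HasFDerivAt (fun φ => ∫ x, Real.exp (inner ℝ φ (t x)) ∂ν)
      (∫ x, Real.exp (inner ℝ θ (t x)) • innerSL ℝ (t x) ∂ν) θ := by
    refine hasFDerivAt_integral_of_dominated_of_fderiv_le
      (F' := fun φ x => Real.exp (inner ℝ φ (t x)) • innerSL ℝ (t x))
      (bound := fun _ => Real.exp ((‖θ‖ + 1) * R) * R)
      (Metric.ball_mem_nhds θ one_pos) (Filter.Eventually.of_forall hmeas)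
      (integrable_exp_inner ht hR θ) hmeas'.aestronglyMeasurable
      (Filter.Eventually.of_forall hbound) (integrable_const _)
      (Filter.Eventually.of_forall fun x φ _ => ?_)
    have h1 : HasFDerivAt (fun φ : EuclideanSpace ℝ (Fin d) => inner ℝ φ (t x))
        (innerSL ℝ (t x)) φ := by
      refine (innerSL ℝ (t x)).hasFDerivAt.congr_of_eventuallyEq
        (Filter.Eventually.of_forall fun ψ => ?_)
      simp [real_inner_comm]
    exact h1.exp
  have hlog := hI.log hpos.ne'
  rw [hasGradientAt_iff_hasFDerivAt]
  refine hlog.congr_fderiv ?_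
  have hint : Integrable (fun x => Real.exp (inner ℝ θ (t x)) • innerSL ℝ (t x)) ν :=
    .of_bound hmeas'.aestronglyMeasurable _ (Filter.Eventually.of_forall fun x =>
      hbound x θ (Metric.mem_ball_self one_pos))
  have hprob := isProbabilityMeasure_expFamily (ν := ν) ht hR θ
  ext u
  rw [InnerProductSpace.toDual_apply_apply, real_inner_comm,
    ← integral_inner (integrable_of_norm_le ht hR), expFamily_eq_tilted ht hR, integral_tilted,
    smul_apply, ContinuousLinearMap.integral_apply hint, smul_eq_mul,
    ← integral_const_mul]
  refine integral_congr_ae (Filter.Eventually.of_forall fun x => ?_)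
  simp only [smul_apply, innerSL_apply_apply, smul_eq_mul, real_inner_comm]
  ring

/-- The log-partition function is convex. -/
theorem logPartition_add_inner_le [NeZero ν] (ht : Measurable t) (hR : ∀ x, ‖t x‖ ≤ R)
    (θ φ : EuclideanSpace ℝ (Fin d)) :
    logPartition ν t θ + inner ℝ (∫ x, t x ∂(expFamily ν t θ)) (φ - θ) ≤ logPartition ν t φ := by
  have hprob := isProbabilityMeasure_expFamily (ν := ν) ht hR θ
  have hθ := integral_exp_pos (integrable_exp_inner (ν := ν) ht hR θ)
  have hφ := integral_exp_pos (integrable_exp_inner (ν := ν) ht hR φ)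
  have hti := integrable_of_norm_le (μ := expFamily ν t θ) ht hR
  set m := inner ℝ (∫ x, t x ∂(expFamily ν t θ)) (φ - θ) with hm
  have hmint : ∫ x, inner ℝ (φ - θ) (t x) ∂(expFamily ν t θ) = m := by
    rw [integral_inner hti, hm, real_inner_comm]
  have hratio : ∫ x, Real.exp (inner ℝ (φ - θ) (t x)) ∂(expFamily ν t θ)
      = (∫ x, Real.exp (inner ℝ φ (t x)) ∂ν) / ∫ x, Real.exp (inner ℝ θ (t x)) ∂ν := by
    rw [expFamily_eq_tilted ht hR, integral_exp_tilted]
    simp [← inner_add_left]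
  -- Jensen's inequality, by integrating the tangent line of `exp` at the mean `m`; the right side
  -- is `exp (A(φ) - A(θ))`.
  have hle : Real.exp m ≤ ∫ x, Real.exp (inner ℝ (φ - θ) (t x)) ∂(expFamily ν t θ) := by
    have hii : Integrable (fun x => inner ℝ (φ - θ) (t x)) (expFamily ν t θ) :=
      hti.const_inner _
    have hii' : Integrable (fun x => inner ℝ (φ - θ) (t x) - m) (expFamily ν t θ) :=
      hii.sub (integrable_const m)
    have h1 : ∫ x, Real.exp m * (1 + (inner ℝ (φ - θ) (t x) - m)) ∂(expFamily ν t θ)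
        = Real.exp m := by
      rw [integral_const_mul, integral_add (integrable_const _) hii',
        integral_sub hii (integrable_const _), hmint]
      simp
    rw [← h1]
    refine integral_mono (((integrable_const _).add hii').const_mul _)
      (integrable_exp_inner ht hR _) fun x => ?_
    have h2 := Real.add_one_le_exp (inner ℝ (φ - θ) (t x) - m)
    have h3 : Real.exp (inner ℝ (φ - θ) (t x))
        = Real.exp m * Real.exp (inner ℝ (φ - θ) (t x) - m) := by
      rw [← Real.exp_add, add_sub_cancel]
    simp only
    rw [h3]
    exact mul_le_mul_of_nonneg_left (by linarith) (Real.exp_pos _).le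
  rw [hratio] at hle
  have h4 := Real.log_le_log (Real.exp_pos _) hle
  rw [Real.log_exp, Real.log_div hφ.ne' hθ.ne'] at h4
  simp only [logPartition]
  linarith

theorem hasGradientAt_regNegLogLik [NeZero ν] (ht : Measurable t) (hR : ∀ x, ‖t x‖ ≤ R)
    (hn : 0 < n) (z : Fin n → X) (lam : ℝ) (θ : EuclideanSpace ℝ (Fin d)) :
    HasGradientAt (regNegLogLik ν t z lam)
      (∫ x, t x ∂(expFamily ν t θ) - dataMean t z + lam • θ) θ := by
  have h1 := hasGradientAt_logPartition (ν := ν) ht hR θ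
  rw [hasGradientAt_iff_hasFDerivAt] at h1 ⊢
  have h2 : HasFDerivAt (fun φ => inner ℝ (dataMean t z) φ) (innerSL ℝ (dataMean t z)) θ :=
    (innerSL ℝ (dataMean t z)).hasFDerivAt
  have h3 := ((hasStrictFDerivAt_norm_sq θ).hasFDerivAt.const_mul (lam / 2))
  have h4 := (h1.sub h2).add h3
  rw [show regNegLogLik ν t z lam = fun φ =>
    logPartition ν t φ - inner ℝ (dataMean t z) φ + lam / 2 * ‖φ‖ ^ 2 from
    funext fun φ => regNegLogLik_eq hn z lam φ]
  refine h4.congr_fderiv ?_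
  ext u
  simp [InnerProductSpace.toDual_apply_apply]
  ring

/-- The regularized negative log-likelihood is `lam`-strongly convex. -/
theorem regNegLogLik_quadratic_le [NeZero ν] (ht : Measurable t) (hR : ∀ x, ‖t x‖ ≤ R)
    (hn : 0 < n) (z : Fin n → X) (lam : ℝ) (θ φ : EuclideanSpace ℝ (Fin d)) :
    regNegLogLik ν t z lam θ
      + inner ℝ (∫ x, t x ∂(expFamily ν t θ) - dataMean t z + lam • θ) (φ - θ)
      + lam / 2 * ‖φ - θ‖ ^ 2 ≤ regNegLogLik ν t z lam φ := by
  have h := logPartition_add_inner_le (ν := ν) ht hR θ φ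
  rw [regNegLogLik_eq hn, regNegLogLik_eq hn, @norm_sub_sq_real, inner_add_left, inner_sub_left,
    real_inner_smul_left, inner_sub_right (dataMean t z), inner_sub_right θ,
    real_inner_self_eq_norm_sq, real_inner_comm θ φ]
  linarith

end ExponentialFamilyCalculus

/-! ### Total variation controls differences of expectations. -/

section TotalVariation

variable {X : Type*} [MeasurableSpace X] (P Q : Measure X) [IsProbabilityMeasure P]
  [IsProbabilityMeasure Q]

theorem measureReal_sub_le_tvDist {A : Set X} (hA : MeasurableSet A) :
    P.real A - Q.real A ≤ tvDist P Q := by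
  refine (le_abs_self _).trans (le_ciSup (f := fun A : {A : Set X // MeasurableSet A} =>
    |P.real A.1 - Q.real A.1|) ⟨1, ?_⟩ ⟨A, hA⟩)
  rintro _ ⟨B, rfl⟩
  simp only
  rw [abs_le]
  have h1 := measureReal_le_one (μ := P) (s := B.1)
  have h2 := measureReal_le_one (μ := Q) (s := B.1)
  have h3 := measureReal_nonneg (μ := P) (s := B.1)
  have h4 := measureReal_nonneg (μ := Q) (s := B.1)
  constructor <;> linarith

theorem tvDist_nonneg {X : Type*} [MeasurableSpace X] (P Q : Measure X) : 0 ≤ tvDist P Q := Real.iSup_nonneg fun _ => abs_nonneg _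

theorem integral_sub_integral_le_tvDist {f : X → ℝ} (hf : Measurable f) {R : ℝ}
    (hR : ∀ x, |f x| ≤ R) : ∫ x, f x ∂P - ∫ x, f x ∂Q ≤ 2 * R * tvDist P Q := by
  obtain ⟨x₀⟩ := P.nonempty_of_neZero
  have hR0 : 0 ≤ R := (abs_nonneg _).trans (hR x₀)
  -- Layer cake for `f + R`, with values in `[0, 2R]`: the superlevel sets compare pointwise by
  -- `tvDist`, and the interval length gives the factor `2R`.
  have layer : ∀ (μ : Measure X) [IsProbabilityMeasure μ],
      ∫ x, f x ∂μ + R = ∫ s in Set.Ioc 0 (2 * R), μ.real {x | s ≤ f x + R} := by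
    intro μ _
    have hfi := integrable_of_abs_le (μ := μ) hf hR
    have hfi' : Integrable (fun x => f x + R) μ := hfi.add (integrable_const R)
    rw [← Integrable.integral_eq_integral_Ioc_meas_le hfi'
      (Filter.Eventually.of_forall fun x => ?_) (Filter.Eventually.of_forall fun x => ?_)]
    · rw [integral_add hfi (integrable_const R)]
      simp
    · have := (abs_le.1 (hR x)).1
      simp only [Pi.zero_apply]
      linarith
    · have := (abs_le.1 (hR x)).2
      linarith
  have hint : ∀ (μ : Measure X) [IsProbabilityMeasure μ],
      IntegrableOn (fun s => μ.real {x | s ≤ f x + R}) (Set.Ioc 0 (2 * R)) := by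
    intro μ _
    have hanti : Antitone fun s => μ.real {x | s ≤ f x + R} := fun s s' h =>
      measureReal_mono fun x hx => h.trans hx
    exact .of_bound measure_Ioc_lt_top hanti.measurable.aestronglyMeasurable 1
      (Filter.Eventually.of_forall fun s => by
        rw [Real.norm_of_nonneg measureReal_nonneg]
        exact measureReal_le_one)
  have h1 : ∫ x, f x ∂P - ∫ x, f x ∂Q
      = ∫ s in Set.Ioc 0 (2 * R), (P.real {x | s ≤ f x + R} - Q.real {x | s ≤ f x + R}) := by
    rw [integral_sub (hint P) (hint Q), ← layer P, ← layer Q]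
    ring
  rw [h1]
  refine (integral_mono ((hint P).sub (hint Q)) (integrable_const (tvDist P Q)) fun s =>
    measureReal_sub_le_tvDist P Q (measurableSet_le measurable_const (hf.add_const R))).trans ?_
  simp [hR0]

/-- Testing the scalar bound against the difference vector `u` itself avoids any dependence on the
dimension. -/
theorem norm_integral_sub_integral_le_tvDist {d : ℕ} {t : X → EuclideanSpace ℝ (Fin d)}
    (ht : Measurable t) {R : ℝ} (hR : ∀ x, ‖t x‖ ≤ R) :
    ‖∫ x, t x ∂P - ∫ x, t x ∂Q‖ ≤ 2 * R * tvDist P Q := by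
  obtain ⟨x₀⟩ := P.nonempty_of_neZero
  have hR0 : 0 ≤ R := (norm_nonneg _).trans (hR x₀)
  set u := ∫ x, t x ∂P - ∫ x, t x ∂Q with hu
  have h := integral_sub_integral_le_tvDist P Q (f := fun x => inner ℝ u (t x)) (by fun_prop)
    (R := ‖u‖ * R) fun x => (abs_real_inner_le_norm _ _).trans
      (mul_le_mul_of_nonneg_left (hR x) (norm_nonneg _))
  rw [integral_inner (integrable_of_norm_le ht hR), integral_inner (integrable_of_norm_le ht hR),
    ← inner_sub_right, ← hu, real_inner_self_eq_norm_sq] at h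
  rcases (norm_nonneg u).eq_or_lt with h0 | h0
  · rw [← h0]
    exact mul_nonneg (by positivity) (tvDist_nonneg P Q)
  · refine le_of_mul_le_mul_left ?_ h0
    linarith

end TotalVariation

/-! ### One step of the algorithm with an inexact gradient. -/

section Descent

variable {X : Type*} [MeasurableSpace X] {d n : ℕ} {ν : Measure X} [IsFiniteMeasure ν] [NeZero ν]
  {t : X → EuclideanSpace ℝ (Fin d)} {R : ℝ}

theorem regNegLogLik_le_quadratic (ht : Measurable t) (hR : ∀ x, ‖t x‖ ≤ R) (hn : 0 < n)
    (z : Fin n → X) {lam L : ℝ}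
    (hLip : ∀ θ φ : EuclideanSpace ℝ (Fin d), ‖gradient (regNegLogLik ν t z lam) θ -
        gradient (regNegLogLik ν t z lam) φ‖ ≤ L * ‖θ - φ‖) (θ φ : EuclideanSpace ℝ (Fin d)) :
    regNegLogLik ν t z lam φ ≤ regNegLogLik ν t z lam θ
      + inner ℝ (∫ x, t x ∂(expFamily ν t θ) - dataMean t z + lam • θ) (φ - θ)
      + L / 2 * ‖φ - θ‖ ^ 2 := by
  have hg := hasGradientAt_regNegLogLik (ν := ν) ht hR hn z lam
  refine le_quadratic_of_lipschitz_gradient hg (fun x y => ?_) θ φ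
  have := hLip x y
  rwa [(hg x).gradient, (hg y).gradient] at this

/-- In positive dimension a Lipschitz constant of the gradient is at least the strong convexity
parameter. -/
theorem le_of_lipschitz_gradient_regNegLogLik [Nontrivial (EuclideanSpace ℝ (Fin d))]
    (ht : Measurable t) (hR : ∀ x, ‖t x‖ ≤ R) (hn : 0 < n) (z : Fin n → X) {lam L : ℝ}
    (hLip : ∀ θ φ : EuclideanSpace ℝ (Fin d), ‖gradient (regNegLogLik ν t z lam) θ -
        gradient (regNegLogLik ν t z lam) φ‖ ≤ L * ‖θ - φ‖) : lam ≤ L := by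
  obtain ⟨θ, hθ⟩ := exists_ne (0 : EuclideanSpace ℝ (Fin d))
  have h := (regNegLogLik_quadratic_le (ν := ν) ht hR hn z lam 0 θ).trans
    (regNegLogLik_le_quadratic ht hR hn z hLip 0 θ)
  rw [sub_zero] at h
  have hpos : 0 < ‖θ‖ ^ 2 := pow_pos (norm_pos_iff.2 hθ) 2
  refine le_of_mul_le_mul_right ?_ hpos
  linarith

/-- One step of the algorithm contracts the distance to the constrained minimizer, up to the error
of the gradient estimate. -/
theorem norm_update_sub_le (ht : Measurable t) (hR : ∀ x, ‖t x‖ ≤ R) (hn : 0 < n)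
    (z : Fin n → X) {lam L : ℝ} (hL : 0 < L) (hle : lam ≤ L)
    (hLip : ∀ θ φ : EuclideanSpace ℝ (Fin d), ‖gradient (regNegLogLik ν t z lam) θ -
        gradient (regNegLogLik ν t z lam) φ‖ ≤ L * ‖θ - φ‖)
    {Θ : Set (EuclideanSpace ℝ (Fin d))} (hΘc : IsClosed Θ) (hΘ : Convex ℝ Θ)
    {θs : EuclideanSpace ℝ (Fin d)} (hθs : θs ∈ Θ)
    (hmin : IsMinOn (regNegLogLik ν t z lam) Θ θs) {m : ℕ} (θ : EuclideanSpace ℝ (Fin d))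
    (x : Fin m → X) :
    ‖update t z lam L Θ θ x - θs‖ ≤ (1 - lam / L) * ‖θ - θs‖
      + 1 / L * ‖(1 / (m : ℝ)) • (∑ i, t (x i)) - ∫ y, t y ∂(expFamily ν t θ)‖ := by
  let g : EuclideanSpace ℝ (Fin d) → EuclideanSpace ℝ (Fin d) := fun θ =>
    ∫ x, t x ∂(expFamily ν t θ) - dataMean t z + lam • θ
  have hfix : proj Θ (θs - (1 / L) • g θs) = θs := by
    refine proj_eq_of_inner_nonpos hΘc hΘ hθs fun w hw => ?_
    have h := inner_gradient_nonneg_of_isMinOn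
      (hasGradientAt_regNegLogLik (ν := ν) ht hR hn z lam θs) hΘ hθs hmin hw
    rw [sub_sub_cancel_left, inner_neg_left, real_inner_smul_left, neg_nonpos]
    exact mul_nonneg (by positivity) h
  have hcontr := gradient_step_contraction (g := g) hL hle
    (regNegLogLik_quadratic_le (ν := ν) ht hR hn z lam)
    (regNegLogLik_le_quadratic ht hR hn z hLip) θ θs
  set u := (1 / (m : ℝ)) • (∑ i, t (x i)) - ∫ y, t y ∂(expFamily ν t θ) with hu
  -- The data mean and the ridge term are exact, so the sample mean is the only source of error.
  have hest : gradEstimate t z lam θ x = g θ + u := by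
    simp only [gradEstimate, g, hu]
    abel
  have hproj := norm_proj_sub_proj_le hΘc hΘ ⟨θs, hθs⟩
    (θ - (1 / L) • gradEstimate t z lam θ x) (θs - (1 / L) • g θs)
  rw [hfix] at hproj
  refine hproj.trans ?_
  have e : θ - (1 / L) • gradEstimate t z lam θ x - (θs - (1 / L) • g θs)
      = (θ - (1 / L) • g θ - (θs - (1 / L) • g θs)) - (1 / L) • u := by
    rw [hest]
    module
  rw [e]
  refine (norm_sub_le _ _).trans (add_le_add hcontr (le_of_eq ?_))
  rw [norm_smul, Real.norm_of_nonneg (by positivity)]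

end Descent

/-! ### The union bound along the chain of iterates. -/

section IterateLaw

/-- If from every point of `S` a random step ends outside `S'` with probability at most `p`, then
after the step the probability to be outside `S'` grows by at most `p`. -/
theorem measureReal_map_compProd_compl_le {E Y : Type*} [MeasurableSpace E] [MeasurableSpace Y]
    (μ : Measure E) [IsProbabilityMeasure μ] (κ : Kernel E Y) [IsMarkovKernel κ] {U : E × Y → E}
    (hU : Measurable U) {S S' : Set E} (hS : MeasurableSet S) (hS' : MeasurableSet S') {p : ℝ}
    (hp : 0 ≤ p) (h : ∀ a ∈ S, (κ a).real {y | U (a, y) ∉ S'} ≤ p) :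
    ((μ ⊗ₘ κ).map U).real S'ᶜ ≤ μ.real Sᶜ + p := by
  have hpt : ∀ a, κ a (Prod.mk a ⁻¹' (U ⁻¹' S'ᶜ)) ≤ Sᶜ.indicator 1 a + ENNReal.ofReal p := by
    intro a
    by_cases ha : a ∈ S
    · refine le_add_left ?_
      rw [← ofReal_measureReal]
      exact ENNReal.ofReal_le_ofReal (h a ha)
    · rw [Set.indicator_of_mem (by exact ha)]
      exact le_add_right prob_le_one
  have hle : ((μ ⊗ₘ κ).map U) S'ᶜ ≤ μ Sᶜ + ENNReal.ofReal p := by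
    rw [Measure.map_apply hU hS'.compl, Measure.compProd_apply (hU hS'.compl)]
    refine (lintegral_mono hpt).trans (le_of_eq ?_)
    rw [lintegral_add_right _ measurable_const, lintegral_indicator_one hS.compl]
    simp
  have := ENNReal.toReal_mono (by finiteness) hle
  rwa [ENNReal.toReal_add (by finiteness) (by finiteness), ENNReal.toReal_ofReal hp] at this

variable {X : Type*} [MeasurableSpace X] {d n : ℕ} {t : X → EuclideanSpace ℝ (Fin d)}
  {Θ : Set (EuclideanSpace ℝ (Fin d))}

instance isMarkovKernel_sampleKernel {E : Type*} [MeasurableSpace E] (T : Kernel (E × X) X)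
    [IsMarkovKernel T] (v : ℕ) (r : Measure X) [IsProbabilityMeasure r] (m : ℕ) :
    IsMarkovKernel (sampleKernel T v r m) :=
  ⟨fun θ => inferInstanceAs (IsProbabilityMeasure (Measure.pi fun _ => chainLaw T θ v r))⟩

theorem measurable_update (ht : Measurable t) (z : Fin n → X) (lam L : ℝ) (hΘc : IsClosed Θ)
    (hΘ : Convex ℝ Θ) (hne : Θ.Nonempty) (m : ℕ) :
    Measurable fun y : EuclideanSpace ℝ (Fin d) × (Fin m → X) =>
      update t z lam L Θ y.1 y.2 := by
  refine (continuous_proj hΘc hΘ hne).measurable.comp ?_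
  simp only [gradEstimate]
  have : ∀ i, Measurable fun y : EuclideanSpace ℝ (Fin d) × (Fin m → X) => t (y.2 i) :=
    fun i => ht.comp ((measurable_pi_apply i).comp measurable_snd)
  fun_prop

variable (T : Kernel (EuclideanSpace ℝ (Fin d) × X) X) [IsMarkovKernel T]
  (r : Measure X) [IsProbabilityMeasure r]

theorem isProbabilityMeasure_iterateLaw (ht : Measurable t) (z : Fin n → X) (lam L : ℝ)
    (hΘc : IsClosed Θ) (hΘ : Convex ℝ Θ) (hne : Θ.Nonempty) (m v : ℕ)
    (θ₀ : EuclideanSpace ℝ (Fin d)) (k : ℕ) :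
    IsProbabilityMeasure (iterateLaw t z lam L Θ T r m v θ₀ k) := by
  induction k with
  | zero => exact Measure.dirac.isProbabilityMeasure
  | succ k ih =>
    exact Measure.isProbabilityMeasure_map
      (measurable_update ht z lam L hΘc hΘ hne m).aemeasurable

/-- If a sequence of sets is left in each step with probability at most `p`, then the `k`-th
iterate is outside the `k`-th set with probability at most `k p`. -/
theorem iterateLaw_compl_le (ht : Measurable t) (z : Fin n → X) (lam L : ℝ)
    (hΘc : IsClosed Θ) (hΘ : Convex ℝ Θ) (hne : Θ.Nonempty) (m v : ℕ)
    (θ₀ : EuclideanSpace ℝ (Fin d)) {S : ℕ → Set (EuclideanSpace ℝ (Fin d))}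
    (hS : ∀ k, MeasurableSet (S k)) (h0 : θ₀ ∈ S 0) {p : ℝ} (hp : 0 ≤ p)
    (hstep : ∀ k, ∀ θ ∈ S k, (Measure.pi fun _ : Fin m => chainLaw T θ v r).real
      {x | update t z lam L Θ θ x ∉ S (k + 1)} ≤ p) (k : ℕ) :
    (iterateLaw t z lam L Θ T r m v θ₀ k).real (S k)ᶜ ≤ k * p := by
  induction k with
  | zero => simp [iterateLaw, measureReal_def, Measure.dirac_apply' _ (hS 0).compl, h0]
  | succ k ih =>
    have := isProbabilityMeasure_iterateLaw T r ht z lam L hΘc hΘ hne m v θ₀ k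
    refine (measureReal_map_compProd_compl_le (iterateLaw t z lam L Θ T r m v θ₀ k)
      (sampleKernel T v r m) (measurable_update ht z lam L hΘc hΘ hne m) (hS k) (hS (k + 1)) hp
      (hstep k)).trans ?_
    push_cast
    linarith

end IterateLaw

/-! ### What the schedule guarantees, and its cost. -/

section Schedule

/-- Uses `(1 - x)^K ≤ exp (-K x)`. The case `D = 0` is separate because there the logarithm takes
its default value. -/
theorem one_sub_pow_mul_le_of_stepBound_le {L lam D β ε : ℝ} {K : ℕ} (hL : 0 < L)
    (hlam : 0 < lam) (hle : lam ≤ L) (hD : 0 ≤ D) (hβ : 0 < β) (hε : 0 < ε)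
    (hK : stepBound L lam D β ε ≤ K) : (1 - lam / L) ^ K * D ≤ β * ε := by
  rcases hD.eq_or_lt with rfl | hD
  · simpa using (mul_pos hβ hε).le
  have h0 : 0 ≤ 1 - lam / L := by rw [sub_nonneg, div_le_one hL]; exact hle
  have h1 : (1 - lam / L) ^ K ≤ Real.exp (-(K * (lam / L))) := by
    rw [← mul_neg, Real.exp_nat_mul]
    exact pow_le_pow_left₀ h0 (Real.one_sub_le_exp_neg _) K
  have h2 : Real.log (D / (β * ε)) ≤ K * (lam / L) := by
    rw [stepBound, div_mul_eq_mul_div, div_le_iff₀ hlam] at hK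
    rw [← mul_div_assoc, le_div_iff₀ hL]
    linarith
  have h3 : Real.exp (-(K * (lam / L))) ≤ β * ε / D := by
    rw [← Real.exp_log (show 0 < β * ε / D by positivity), Real.exp_le_exp,
      ← inv_div D, Real.log_inv]
    linarith
  exact (mul_le_mul_of_nonneg_right (h1.trans h3) hD.le).trans (by field_simp; rfl)

/-- After squaring, `R²` is needed where `sampleBound` offers `l² R / 2`; this is why `effLip`
dominates `√(2 R₂)`. -/
theorem noise_le_of_sampleBound_le {l R lam β ε δ K : ℝ} {M : ℕ} (hR : 0 ≤ R)
    (hlR : 2 * R ≤ l ^ 2) (hlam : 0 < lam) (hβ : 0 < β) (hε : 0 < ε) (hM : 1 ≤ M)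
    (h : sampleBound l R lam β ε δ K ≤ M) :
    R / √M * (1 + √(2 * Real.log (K / δ))) ≤ β * ε * lam := by
  rw [sampleBound] at h
  set s := 1 + √(2 * Real.log (K / δ)) with hs
  have hM0 : (0 : ℝ) < M := by exact_mod_cast hM
  rw [div_mul_eq_mul_div, div_le_iff₀ (by positivity)] at h
  refine abs_le_of_sq_le_sq' ?_ (by positivity) |>.2
  rw [mul_pow, div_pow, Real.sq_sqrt hM0.le, div_mul_eq_mul_div, div_le_iff₀ hM0]
  have h2 : 2 * R * (R * s ^ 2) ≤ l ^ 2 * (R * s ^ 2) :=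
    mul_le_mul_of_nonneg_right hlR (by positivity)
  linarith

/-- Rests on `log α ≤ α - 1`. The superfluous factor `l` in the logarithm does no harm once `l ≥ 1`,
which is why `effLip` dominates `1`. -/
theorem bias_le_of_transitionBound_le {l R lam β ε C α : ℝ} {v : ℕ} (hl : 1 ≤ l)
    (hlam : 0 < lam) (hβ : 0 < β) (hε : 0 < ε) (hα₀ : 0 < α) (hα₁ : α < 1)
    (h : transitionBound l R lam β ε C α ≤ v) : 2 * R * (C * α ^ v) ≤ β * ε * lam := by
  have hb : 0 < β * ε * lam := by positivity
  have hl0 : 0 < l := by linarith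
  rcases le_or_gt (R * C) 0 with hRC | hRC
  · have := mul_nonpos_of_nonpos_of_nonneg hRC (pow_nonneg hα₀.le v)
    linarith
  set q := 2 * l * R * C / (β * ε * lam) with hq
  have hq0 : 0 < q := by
    rw [hq, show 2 * l * R * C = 2 * l * (R * C) by ring]
    positivity
  have h1 : Real.log q ≤ v * (1 - α) := by
    rw [transitionBound, ← hq, one_div, inv_mul_le_iff₀ (by linarith)] at h
    linarith
  have h2 : Real.log (q * α ^ v) ≤ 0 := by
    rw [Real.log_mul hq0.ne' (by positivity), Real.log_pow]
    have := mul_le_mul_of_nonneg_left (Real.log_le_sub_one_of_pos hα₀) (Nat.cast_nonneg (α := ℝ) v)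
    linarith
  have h3 : q * α ^ v ≤ 1 := (Real.log_nonpos_iff (by positivity)).1 h2
  rw [hq, div_mul_eq_mul_div, div_le_one hb] at h3
  have h4 : 0 ≤ 2 * (R * C) * α ^ v := by positivity
  have h5 := mul_le_mul_of_nonneg_right hl h4
  linarith

theorem log_div_mono {a b δ : ℝ} (ha : 0 < a) (hab : a ≤ b) (hδ : 0 < δ) :
    Real.log (a / δ) ≤ Real.log (b / δ) :=
  Real.log_le_log (by positivity) (by gcongr)

theorem sampleBound_mono {l R lam β ε δ a b : ℝ} (hR : 0 ≤ R) (hδ : 0 < δ) (ha : 0 < a)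
    (hab : a ≤ b) : sampleBound l R lam β ε δ a ≤ sampleBound l R lam β ε δ b := by
  rw [sampleBound, sampleBound]
  have := log_div_mono ha hab hδ
  gcongr

theorem sampleBound_nonneg {l R lam β ε δ K : ℝ} (hR : 0 ≤ R) :
    0 ≤ sampleBound l R lam β ε δ K := by
  rw [sampleBound]
  positivity

theorem one_le_effLip (L R : ℝ) : 1 ≤ effLip L R :=
  (le_max_left _ _).trans (le_max_right _ _)

theorem two_mul_le_effLip_sq (L : ℝ) {R : ℝ} (hR : 0 ≤ R) : 2 * R ≤ effLip L R ^ 2 := by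
  have h : √(2 * R) ≤ effLip L R := (le_max_right _ _).trans (le_max_right _ _)
  calc 2 * R = √(2 * R) ^ 2 := (Real.sq_sqrt (by positivity)).symm
    _ ≤ _ := pow_le_pow_left₀ (Real.sqrt_nonneg _) h 2

/-- Monotonicity replaces `K` inside `sampleBound` by its upper bound. The upper bounds for `K` and
`v` are nonnegative because they dominate natural numbers, so the three estimates may be multiplied
whatever the signs of the logarithms. -/
theorem work_le {L l R lam D β₁ β₂ β₃ ε δ C α c : ℝ} {K M v : ℕ} (hR : 0 ≤ R) (hlam : 0 < lam)
    (hδ : 0 < δ) (hc : 1 ≤ c) (hK1 : 1 ≤ K)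
    (hK : K ≤ c * stepBound L lam D β₁ ε) (hM : M ≤ c * sampleBound l R lam β₂ ε δ K)
    (hv : v ≤ c * transitionBound l R lam β₃ ε C α) :
    (K * M * v : ℝ) ≤ c ^ 3 * (L * l ^ 2 * R / (2 * ε ^ 2 * β₂ ^ 2 * lam ^ 3 * (1 - α)) *
      Real.log (D / (β₁ * ε)) *
      (1 + √(2 * Real.log (c * (L / (lam * δ) * Real.log (D / (β₁ * ε)))))) ^ 2 *
      Real.log (2 * l * R * C / (β₃ * ε * lam))) := by
  have hK0 : (0 : ℝ) < K := by exact_mod_cast hK1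
  have hmono : sampleBound l R lam β₂ ε δ K
      ≤ sampleBound l R lam β₂ ε δ (c * stepBound L lam D β₁ ε) :=
    sampleBound_mono hR hδ hK0 hK
  have hM' := hM.trans (mul_le_mul_of_nonneg_left hmono (by linarith))
  have hv0 : 0 ≤ c * transitionBound l R lam β₃ ε C α := (Nat.cast_nonneg v).trans hv
  have hM0 : 0 ≤ c * sampleBound l R lam β₂ ε δ (c * stepBound L lam D β₁ ε) :=
    mul_nonneg (by linarith) (sampleBound_nonneg hR)
  have h := mul_le_mul (mul_le_mul hK hM' (Nat.cast_nonneg M) (hK0.le.trans hK)) hv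
    (Nat.cast_nonneg v) (mul_nonneg (hK0.le.trans hK) hM0)
  refine h.trans (le_of_eq ?_)
  have e : c * stepBound L lam D β₁ ε / δ = c * (L / (lam * δ) * Real.log (D / (β₁ * ε))) := by
    rw [stepBound]
    field_simp
  rw [sampleBound, e, stepBound, transitionBound]
  have e2 : L * l ^ 2 * R / (2 * ε ^ 2 * β₂ ^ 2 * lam ^ 3 * (1 - α))
      = L / lam * (l ^ 2 * R / (2 * ε ^ 2 * β₂ ^ 2 * lam ^ 2)) * (1 / (1 - α)) := by
    rw [div_mul_div_comm, div_mul_div_comm]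
    congr 1 <;> ring
  rw [e2]
  ring

theorem work_ceil_le {R : ℝ} {κ η l lam β ε δ : ℝ} {K M v : ℕ} (hR : 0 ≤ R) (hδ : 0 < δ)
    (hK : K = max 1 ⌈κ⌉₊) (hM : M = max 1 ⌈sampleBound l R lam β ε δ K⌉₊) (hv : v = ⌈η⌉₊) :
    (K * M * v : ℝ) ≤ (max 0 κ + 1) * (sampleBound l R lam β ε δ (max 0 κ + 1) + 1)
      * (max 0 η + 1) := by
  have hceil : ∀ x : ℝ, (⌈x⌉₊ : ℝ) ≤ max 0 x + 1 := fun x => by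
    rcases le_or_gt x 0 with h | h
    · simp [Nat.ceil_eq_zero.2 h, h]
    · rw [max_eq_right h.le]
      exact (Nat.ceil_lt_add_one h.le).le
  have hceil' : ∀ x : ℝ, ((max 1 ⌈x⌉₊ : ℕ) : ℝ) ≤ max 0 x + 1 := fun x => by
    rw [Nat.cast_max]
    exact max_le (by simp) (hceil x)
  have h1 : (K : ℝ) ≤ max 0 κ + 1 := hK ▸ hceil' κ
  have hK0 : (0 : ℝ) < K := by
    have : 1 ≤ K := hK ▸ le_max_left _ _
    exact_mod_cast this
  have h2 : (M : ℝ) ≤ sampleBound l R lam β ε δ (max 0 κ + 1) + 1 := by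
    rw [hM]
    refine (hceil' _).trans ?_
    rw [max_eq_right (sampleBound_nonneg hR)]
    have := sampleBound_mono (l := l) (lam := lam) (β := β) (ε := ε) hR hδ hK0 h1
    linarith
  have h3 : (v : ℝ) ≤ max 0 η + 1 := hv ▸ hceil η
  have := sampleBound_nonneg (l := l) (lam := lam) (β := β) (ε := ε) (δ := δ)
    (K := max 0 κ + 1) hR
  gcongr

end Schedule

/-! ### Accuracy: the pieces combined. -/

section Accuracy

/-- The accuracy guarantee of the algorithm. -/
theorem one_sub_le_iterateLaw {X : Type*} [MeasurableSpace X] {d n : ℕ}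
    (ν : Measure X) [IsFiniteMeasure ν] [NeZero ν]
    {t : X → EuclideanSpace ℝ (Fin d)} (ht : Measurable t) {R : ℝ} (hR : ∀ x, ‖t x‖ ≤ R)
    (hn : 0 < n) (z : Fin n → X) {lam : ℝ} (hlam : 0 < lam) {L : ℝ} (hL : 0 < L)
    (hLip : ∀ θ φ : EuclideanSpace ℝ (Fin d), ‖gradient (regNegLogLik ν t z lam) θ -
        gradient (regNegLogLik ν t z lam) φ‖ ≤ L * ‖θ - φ‖)
    {Θ : Set (EuclideanSpace ℝ (Fin d))} (hΘc : IsClosed Θ) (hΘ : Convex ℝ Θ)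
    {θ₀ : EuclideanSpace ℝ (Fin d)} (hθ₀ : θ₀ ∈ Θ)
    {θs : EuclideanSpace ℝ (Fin d)} (hθs : θs ∈ Θ) (hmin : IsMinOn (regNegLogLik ν t z lam) Θ θs)
    (T : Kernel (EuclideanSpace ℝ (Fin d) × X) X) [IsMarkovKernel T]
    {C α : ℝ} (hα₀ : 0 < α) (hα₁ : α < 1)
    (r : Measure X) [IsProbabilityMeasure r] {v : ℕ}
    (hmix : ∀ θ ∈ Θ, tvDist (chainLaw T θ v r) (expFamily ν t θ) ≤ C * α ^ v)
    {ε : ℝ} (hε : 0 < ε) {δ : ℝ} (hδ₀ : 0 < δ) (hδ₁ : δ < 1)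
    {β₁ β₂ β₃ : ℝ} (hβ₁ : 0 < β₁) (hβ₂ : 0 < β₂) (hβ₃ : 0 < β₃) (hβ : β₁ + β₂ + β₃ = 1)
    {K M : ℕ} (hK1 : 1 ≤ K) (hM1 : 1 ≤ M) (hK : stepBound L lam ‖θ₀ - θs‖ β₁ ε ≤ K)
    (hM : sampleBound (effLip L R) R lam β₂ ε δ K ≤ M)
    (hv : transitionBound (effLip L R) R lam β₃ ε C α ≤ v) :
    1 - δ ≤ (iterateLaw t z lam L Θ T r M v θ₀ K).real {θ | ‖θ - θs‖ ≤ ε} := by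
  have hR0 : 0 ≤ R := (norm_nonneg _).trans (hR (z ⟨0, hn⟩))
  have hprob := isProbabilityMeasure_iterateLaw T r ht z lam L hΘc hΘ ⟨θs, hθs⟩ M v θ₀ K
  -- In dimension zero the Lipschitz condition is vacuous and `lam ≤ L` may fail, but there is
  -- nothing to prove.
  rcases subsingleton_or_nontrivial (EuclideanSpace ℝ (Fin d)) with hsub | hnontriv
  · have huniv : {θ : EuclideanSpace ℝ (Fin d) | ‖θ - θs‖ ≤ ε} = Set.univ := by
      ext θ
      simp [Subsingleton.elim θ θs, hε.le]
    rw [huniv, probReal_univ]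
    linarith
  have hle : lam ≤ L := le_of_lipschitz_gradient_regNegLogLik (ν := ν) ht hR hn z hLip
  have hK0 : (0 : ℝ) < K := by exact_mod_cast hK1
  have hγ : 0 ≤ 1 - lam / L := by rw [sub_nonneg, div_le_one hL]; exact hle
  -- The constant term `b = (β₂ + β₃) ε` is the fixed point of `b ↦ (1 - lam / L) b + (β₂ + β₃) ε
  -- lam / L`, so a step with small error leads from `S k` to `S (k + 1)`. Intersecting with `Θ`
  -- keeps the mixing bound available.
  let S : ℕ → Set (EuclideanSpace ℝ (Fin d)) := fun k =>
    Θ ∩ {θ | ‖θ - θs‖ ≤ (1 - lam / L) ^ k * ‖θ₀ - θs‖ + (β₂ + β₃) * ε}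
  have hS : ∀ k, MeasurableSet (S k) := fun k =>
    hΘc.measurableSet.inter (measurableSet_le (by fun_prop) measurable_const)
  have h0 : θ₀ ∈ S 0 := by
    refine ⟨hθ₀, ?_⟩
    have : 0 < (β₂ + β₃) * ε := by positivity
    simp only [Set.mem_ofPred_eq, pow_zero, one_mul]
    linarith
  have hstep : ∀ k, ∀ θ ∈ S k, (Measure.pi fun _ : Fin M => chainLaw T θ v r).real
      {x | update t z lam L Θ θ x ∉ S (k + 1)} ≤ δ / K := by
    rintro k θ ⟨hθ, hθk⟩
    have hδK : δ / K ≤ 1 := by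
      rw [div_le_one hK0]
      have : (1 : ℝ) ≤ K := by exact_mod_cast hK1
      linarith
    refine (measureReal_mono fun x hx => ?_).trans (measureReal_sampleMean_gt_le
      (chainLaw T θ v r) ht hR hM1 (div_pos hδ₀ hK0) hδK)
    by_contra hx'
    refine hx ⟨(proj_spec hΘc hΘ ⟨θs, hθs⟩ _).1, ?_⟩
    simp only [Set.mem_ofPred_eq, not_lt, one_div_div] at hx' hθk ⊢
    have hnoise := hx'.trans (noise_le_of_sampleBound_le hR0 (two_mul_le_effLip_sq L hR0)
      hlam hβ₂ hε hM1 hM)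
    have hexp := isProbabilityMeasure_expFamily (ν := ν) ht hR θ
    have hbias := (norm_integral_sub_integral_le_tvDist (chainLaw T θ v r) (expFamily ν t θ)
      ht hR).trans ((mul_le_mul_of_nonneg_left (hmix θ hθ) (by positivity)).trans
        (bias_le_of_transitionBound_le (one_le_effLip L R) hlam hβ₃ hε hα₀ hα₁ hv))
    have herr := (norm_sub_le_norm_sub_add_norm_sub ((1 / (M : ℝ)) • (∑ i, t (x i)))
      (∫ y, t y ∂(chainLaw T θ v r)) (∫ y, t y ∂(expFamily ν t θ))).trans
        (add_le_add hnoise hbias)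
    refine (norm_update_sub_le ht hR hn z hL hle hLip hΘc hΘ hθs hmin θ x).trans
      ((add_le_add (mul_le_mul_of_nonneg_left hθk hγ)
        (mul_le_mul_of_nonneg_left herr (by positivity))).trans (le_of_eq ?_))
    rw [pow_succ]
    generalize (1 - lam / L) ^ k = w
    field_simp
    ring
  have hfail := iterateLaw_compl_le T r ht z lam L hΘc hΘ ⟨θs, hθs⟩ M v θ₀ hS h0
    (div_pos hδ₀ hK0).le hstep K
  rw [mul_div_cancel₀ _ hK0.ne', probReal_compl_eq_one_sub (hS K)] at hfail
  have hincl : S K ⊆ {θ | ‖θ - θs‖ ≤ ε} := by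
    rintro θ ⟨-, hθ⟩
    have h1 := one_sub_pow_mul_le_of_stepBound_le hL hlam hle (norm_nonneg _) hβ₁ hε hK
    simp only [Set.mem_ofPred_eq] at hθ ⊢
    have h2 : β₁ * ε + (β₂ + β₃) * ε = ε := by
      rw [← add_mul, ← add_assoc, hβ, one_mul]
    linarith
  have := measureReal_mono (μ := iterateLaw t z lam L Θ T r M v θ₀ K) hincl
  linarith

end Accuracy

end MCMCLearn

theorem mainTheorem5
    {X : Type*} [MeasurableSpace X] {d n : ℕ}
    -- the exponential family, with bounded sufficient statistics
    (ν : MeasureTheory.Measure X) [MeasureTheory.IsFiniteMeasure ν] [NeZero ν]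
    (t : X → EuclideanSpace ℝ (Fin d)) (ht : Measurable t)
    (R₂ : ℝ) (hR₂ : ∀ x, ‖t x‖ ≤ R₂)
    -- the data set and the regularization
    (hn : 0 < n) (z : Fin n → X) (lam : ℝ) (hlam : 0 < lam)
    -- the Lipschitz constant of the gradient of the objective
    (L : ℝ) (hL : 0 < L)
    (hLip : ∀ θ φ : EuclideanSpace ℝ (Fin d),
      ‖gradient (MCMCLearn.regNegLogLik ν t z lam) θ -
        gradient (MCMCLearn.regNegLogLik ν t z lam) φ‖ ≤ L * ‖θ - φ‖)
    -- the constraint set, the starting point and the constrained minimizer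
    (Θ : Set (EuclideanSpace ℝ (Fin d))) (hΘc : IsClosed Θ) (hΘ : Convex ℝ Θ)
    (θ₀ : EuclideanSpace ℝ (Fin d)) (hθ₀ : θ₀ ∈ Θ)
    (θs : EuclideanSpace ℝ (Fin d)) (hθs : θs ∈ Θ)
    (hmin : IsMinOn (MCMCLearn.regNegLogLik ν t z lam) Θ θs)
    -- the Markov chains, which are fast mixing on the constraint set
    (T : ProbabilityTheory.Kernel (EuclideanSpace ℝ (Fin d) × X) X)
    [ProbabilityTheory.IsMarkovKernel T]
    (C α : ℝ) (hα₀ : 0 < α) (hα₁ : α < 1)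
    (hmix : ∀ θ ∈ Θ, ∀ q : MeasureTheory.Measure X, MeasureTheory.IsProbabilityMeasure q →
      ∀ v : ℕ, MCMCLearn.tvDist (MCMCLearn.chainLaw T θ v q) (MCMCLearn.expFamily ν t θ)
        ≤ C * α ^ v)
    -- the distribution from which the chains are started
    (r : MeasureTheory.Measure X) [MeasureTheory.IsProbabilityMeasure r]
    -- the accuracy, the failure probability and the weights
    (ε : ℝ) (hε : 0 < ε) (δ : ℝ) (hδ₀ : 0 < δ) (hδ₁ : δ < 1)
    (β₁ β₂ β₃ : ℝ) (hβ₁ : 0 < β₁) (hβ₂ : 0 < β₂) (hβ₃ : 0 < β₃) (hβ : β₁ + β₂ + β₃ = 1) :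
    -- the accuracy guarantee under the schedule
    (∀ K M v : ℕ, 1 ≤ K → 1 ≤ M →
      MCMCLearn.stepBound L lam ‖θ₀ - θs‖ β₁ ε ≤ K →
      MCMCLearn.sampleBound (MCMCLearn.effLip L R₂) R₂ lam β₂ ε δ K ≤ M →
      MCMCLearn.transitionBound (MCMCLearn.effLip L R₂) R₂ lam β₃ ε C α ≤ v →
      1 - δ ≤ (MCMCLearn.iterateLaw t z lam L Θ T r M v θ₀ K).real {θ | ‖θ - θs‖ ≤ ε}) ∧
    -- the total work, if the schedule is met up to a factor `c` (the case `c = 1` is equality)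
    (∀ (c : ℝ) (K M v : ℕ), 1 ≤ c → 1 ≤ K →
      K ≤ c * MCMCLearn.stepBound L lam ‖θ₀ - θs‖ β₁ ε →
      M ≤ c * MCMCLearn.sampleBound (MCMCLearn.effLip L R₂) R₂ lam β₂ ε δ K →
      v ≤ c * MCMCLearn.transitionBound (MCMCLearn.effLip L R₂) R₂ lam β₃ ε C α →
      (K * M * v : ℝ) ≤
        c ^ 3 * (L * MCMCLearn.effLip L R₂ ^ 2 * R₂ /
            (2 * ε ^ 2 * β₂ ^ 2 * lam ^ 3 * (1 - α)) *
          Real.log (‖θ₀ - θs‖ / (β₁ * ε)) *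
          (1 + √(2 * Real.log (c * (L / (lam * δ) * Real.log (‖θ₀ - θs‖ / (β₁ * ε)))))) ^ 2 *
          Real.log (2 * MCMCLearn.effLip L R₂ * R₂ * C / (β₃ * ε * lam)))) ∧
    -- the total work of the smallest integers that meet the schedule
    (∀ K M v : ℕ,
      K = max 1 ⌈MCMCLearn.stepBound L lam ‖θ₀ - θs‖ β₁ ε⌉₊ →
      M = max 1 ⌈MCMCLearn.sampleBound (MCMCLearn.effLip L R₂) R₂ lam β₂ ε δ K⌉₊ →
      v = ⌈MCMCLearn.transitionBound (MCMCLearn.effLip L R₂) R₂ lam β₃ ε C α⌉₊ →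
      (K * M * v : ℝ) ≤
        (max 0 (MCMCLearn.stepBound L lam ‖θ₀ - θs‖ β₁ ε) + 1) *
        (MCMCLearn.sampleBound (MCMCLearn.effLip L R₂) R₂ lam β₂ ε δ
          (max 0 (MCMCLearn.stepBound L lam ‖θ₀ - θs‖ β₁ ε) + 1) + 1) *
        (max 0 (MCMCLearn.transitionBound (MCMCLearn.effLip L R₂) R₂ lam β₃ ε C α) + 1)) := by
  have hR0 : 0 ≤ R₂ := (norm_nonneg _).trans (hR₂ (z ⟨0, hn⟩))
  refine ⟨fun K M v hK1 hM1 hK hM hv => ?_, fun c K M v hc hK1 hK hM hv => ?_,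
    fun K M v hK hM hv => ?_⟩
  · exact MCMCLearn.one_sub_le_iterateLaw ν ht hR₂ hn z hlam hL hLip hΘc hΘ hθ₀ hθs hmin T hα₀ hα₁
      r (fun θ hθ => hmix θ hθ r inferInstance v) hε hδ₀ hδ₁ hβ₁ hβ₂ hβ₃ hβ hK1 hM1 hK hM hv
  · exact MCMCLearn.work_le hR0 hlam hδ₀ hc hK1 hK hM hv
  · exact MCMCLearn.work_ceil_le hR0 hδ₀ hK hM hv
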